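/- Let $G$ be a compact topological group with a surjective homomorphism $\phi:G\to\{\pm1\}$, and put $G^0=\ker\phi$. A (continuous, finite-dimensional) $\phi$-representation is a finite-dimensional real vector space $V$ with a complex structure $I$ ($I^2=-1$) and a continuous homomorphism $\rho:G\to GL_{\mathbb R}(V)$ with $\rho(g)I=\phi(g)I\rho(g)$; it is a $\phi$-irrep if $V\ne0$ and no real subspace other than $0,V$ is invariant under $I$ and all $\rho(g)$. Let $\mathcal A$ be the real algebra generated by $\rho(G^0)$, $\mathcal B$ the one generated by $\rho(G^0)$ and $I$, $\mathcal D$ the one generated by $\rho(G)$ and $I$, and let the group superalgebra $\mathcal A_s$ be the real algebra generated by $\rho(G)$, with even (odd) part the span of the $\rho(g)$ with $\phi(g)=1$ ($\phi(g)=-1$). Write $\mathbb K(n)$ for the algebra of $n\times n$ matrices over $\mathbb K$. The Dyson type of a $\phi$-irrep is given by the isomorphism classes of $(\mathcal D,\mathcal B,\mathcal A)$, for some $n\ge1$: $\mathbb{RR}$: $(\mathbb R(2n),\mathbb C(n),\mathbb R(n))$; $\mathbb{RC}$: $(\mathbb R(2n),\mathbb C(n),\mathbb C(n))$; $\mathbb{RH}$: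 $(\mathbb R(4n),\mathbb C(2n),\mathbb H(n))$; $\mathbb{CR}$: $(\mathbb C(2n),\mathbb C(n)^{2},\mathbb R(n)^{2})$; $\mathbb{CC}_1$: $(\mathbb C(2n),\mathbb C(n)^{2},\mathbb C(n)^{2})$; $\mathbb{CC}_2$: $(\mathbb C(2n),\mathbb C(n)^{2},\mathbb C(n))$; $\mathbb{CH}$: $(\mathbb C(4n),\mathbb C(2n)^{2},\mathbb H(n)^{2})$; $\mathbb{HR}$: $(\mathbb H(n),\mathbb C(n),\mathbb R(n))$; $\mathbb{HC}$: $(\mathbb H(n),\mathbb C(n),\mathbb C(n))$; $\mathbb{HH}$: $(\mathbb H(2n),\mathbb C(2n),\mathbb H(n))$. Here $X^2$ denotes $X\oplus X$. Two real superalgebras are similar if they are isomorphic, as superalgebras, to $\mathrm{End}(\mathbb R^{m|n})\hat\otimes D$ and $\mathrm{End}(\mathbb R^{p|q})\hat\otimes D$ with the same real division superalgebra $D$ and $m+n,p+q\ge1$. $C\ell_r$ ($C\ell_{-r}$) is the real Clifford superalgebra on $r$ odd anticommuting generators with square $+1$ ($-1$), and $\mathbb C\ell_1$ is the complex Clifford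 superalgebra on one generator, regarded as a real superalgebra. Call $(G,\phi)$ factorizable if there is a homomorphism $s:\{\pm1\}\to G$ with $\phi\circ s=\mathrm{id}$ and, in addition, every (topological) automorphism of $G^0$ is inner or $s(\{\pm1\})$ is normal in $G$. (1) If $(G,\phi)$ is factorizable, then there is $T\in G$ with $\phi(T)=-1$ that commutes with every element of $G^0$. (2) Let $T\in G$ be any element with $\phi(T)=-1$ that commutes with every element of $G^0$ (in particular, $G$ may be any factorizable group). Then every $\phi$-irrep of $G$ has a Dyson type, which is one of $\mathbb{RR}$, $\mathbb{RH}$, $\mathbb{CC}_2$, $\mathbb{HR}$, $\mathbb{HH}$, and $\mathcal A_s$ is similar to $C\ell_1$, $C\ell_3$, $\mathbb C\ell_1$, $C\ell_{-1}$, $C\ell_{-3}$, respectively. Moreover $\rho(T)^2=+1$ for the types $\mathbb{RR}$ and $\mathbb{HH}$, and $\rho(T)^2=-1$ for the types $\mathbb{RH}$ and $\mathbb{HR}$. -/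

import Mathlib

open scoped TensorProduct Quaternion

/-! ### Real superalgebras -/

/-- Parity of the standard basis vectors of the superspace `ℝ^{m|n}`. -/
def basisParity (m n : ℕ) : Fin m ⊕ Fin n → ZMod 2 :=
  Sum.elim (fun _ => 0) (fun _ => 1)

/-- The grading of `End(ℝ^{m|n})`, realized as block matrices: the degree `i` part consists of the
matrices supported on the entries `(a, b)` whose parities add up to `i`. -/
def superEnd (m n : ℕ) (i : ZMod 2) :
    Submodule ℝ (Matrix (Fin m ⊕ Fin n) (Fin m ⊕ Fin n) ℝ) where
  carrier := {M | ∀ a b, basisParity m n a + basisParity m n b ≠ i → M a b = 0}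
  add_mem' := fun hx hy a b h => by simp [hx a b h, hy a b h]
  zero_mem' := fun _ _ _ => rfl
  smul_mem' := fun c x hx a b h => by simp [hx a b h]

theorem mem_superEnd {m n : ℕ} {i : ZMod 2} {M : Matrix (Fin m ⊕ Fin n) (Fin m ⊕ Fin n) ℝ} :
    M ∈ superEnd m n i ↔ ∀ a b, basisParity m n a + basisParity m n b ≠ i → M a b = 0 :=
  Iff.rfl

instance superEnd.gradedMonoid (m n : ℕ) : SetLike.GradedMonoid (superEnd m n) where
  one_mem := by
    intro a b h
    refine Matrix.one_apply_ne ?_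
    rintro rfl
    exact h (CharTwo.add_self_eq_zero _)
  mul_mem := by
    intro i j M N hM hN a b h
    rw [Matrix.mul_apply]
    refine Finset.sum_eq_zero fun c _ => ?_
    by_cases hi : basisParity m n a + basisParity m n c = i
    · rw [hN c b, mul_zero]
      rintro rfl
      apply h
      rw [← hi]
      have := CharTwo.add_self_eq_zero (basisParity m n c)
      linear_combination -this
    · rw [hM a c hi, zero_mul]

/-- The degree `i` component of a block matrix. -/
def superEndProj (m n : ℕ) (i : ZMod 2) :
    Matrix (Fin m ⊕ Fin n) (Fin m ⊕ Fin n) ℝ →ₗ[ℝ] superEnd m n i where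
  toFun M := ⟨Matrix.of fun a b =>
    if basisParity m n a + basisParity m n b = i then M a b else 0, fun a b h => by simp [h]⟩
  map_add' M N := by
    ext a b
    by_cases h : basisParity m n a + basisParity m n b = i <;> simp [h]
  map_smul' c M := by
    ext a b
    by_cases h : basisParity m n a + basisParity m n b = i <;> simp [h]

theorem superEndProj_same {m n : ℕ} {i : ZMod 2} (x : superEnd m n i) :
    superEndProj m n i x = x := by
  ext a b
  by_cases h : basisParity m n a + basisParity m n b = i
  · simp [superEndProj, h]
  · simp [superEndProj, h, x.2 a b h]

theorem superEndProj_ne {m n : ℕ} {i j : ZMod 2} (x : superEnd m n i) (hij : j ≠ i) :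
    superEndProj m n j x = 0 := by
  ext a b
  by_cases h : basisParity m n a + basisParity m n b = j
  · simp [superEndProj, h, x.2 a b (h ▸ hij)]
  · simp [superEndProj, h]

noncomputable instance superEnd.decomposition (m n : ℕ) :
    DirectSum.Decomposition (superEnd m n) :=
  DirectSum.Decomposition.ofLinearMap (superEnd m n)
    (∑ i : ZMod 2, (DirectSum.lof ℝ (ZMod 2) (fun i => superEnd m n i) i) ∘ₗ superEndProj m n i)
    (by
      ext M a b
      simp only [LinearMap.comp_apply, LinearMap.sum_apply, map_sum, DirectSum.coeLinearMap_lof,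
        Matrix.sum_apply, LinearMap.id_apply]
      simp [superEndProj])
    (by
      refine DirectSum.linearMap_ext ℝ fun i => LinearMap.ext fun x => ?_
      simp only [LinearMap.comp_apply, LinearMap.sum_apply, DirectSum.coeLinearMap_lof,
        LinearMap.id_apply]
      rw [Finset.sum_eq_single i]
      · rw [superEndProj_same]
      · intro j _ hj
        rw [superEndProj_ne x hj, map_zero]
      · simp)

noncomputable instance superEnd.gradedAlgebra (m n : ℕ) : GradedAlgebra (superEnd m n) where

/-- The total grading of the graded tensor product of two real superalgebras. -/
noncomputable def tensorGrading {A B : Type*} [Ring A] [Algebra ℝ A] [Ring B] [Algebra ℝ B]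
    (𝒜 : ZMod 2 → Submodule ℝ A) (ℬ : ZMod 2 → Submodule ℝ B) [GradedAlgebra 𝒜] [GradedAlgebra ℬ]
    (i : ZMod 2) : Submodule ℝ (𝒜 ᵍ⊗[ℝ] ℬ) :=
  Submodule.span ℝ {z | ∃ j k : ZMod 2, j + k = i ∧ ∃ a ∈ 𝒜 j, ∃ b ∈ ℬ k,
    z = GradedTensorProduct.tmul ℝ a b}

/-- Isomorphism of superalgebras: a grading-preserving isomorphism of algebras. -/
def SuperIso {A B : Type*} [Ring A] [Algebra ℝ A] [Ring B] [Algebra ℝ B]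
    (𝒜 : ZMod 2 → Submodule ℝ A) (ℬ : ZMod 2 → Submodule ℝ B) : Prop :=
  ∃ f : A ≃ₐ[ℝ] B, ∀ i, (𝒜 i).map f.toLinearMap = ℬ i

/-- A division superalgebra: every nonzero homogeneous element is invertible. -/
def IsDivisionSuperalgebra {D : Type*} [Ring D] [Algebra ℝ D]
    (𝒟 : ZMod 2 → Submodule ℝ D) : Prop :=
  Nontrivial D ∧ ∀ i, ∀ x ∈ 𝒟 i, x ≠ 0 → IsUnit x

/-- `A` is a matrix superalgebra `End(ℝ^{m|n}) ⊗̂ D` over `D`, with `ℝ^{m|n} ≠ 0`. -/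
def IsMatrixSuperalgebraOver {A D : Type*} [Ring A] [Algebra ℝ A] [Ring D] [Algebra ℝ D]
    (𝒜 : ZMod 2 → Submodule ℝ A) (𝒟 : ZMod 2 → Submodule ℝ D) [GradedAlgebra 𝒟] : Prop :=
  ∃ m n : ℕ, 0 < m + n ∧ SuperIso 𝒜 (tensorGrading (superEnd m n) 𝒟)

/-- Similarity of real superalgebras: both are matrix superalgebras over one and the same real
division superalgebra. -/
def SuperSimilar {A B : Type*} [Ring A] [Algebra ℝ A] [Ring B] [Algebra ℝ B]
    (𝒜 : ZMod 2 → Submodule ℝ A) (ℬ : ZMod 2 → Submodule ℝ B) : Prop :=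
  ∃ (D : Type) (_ : Ring D) (_ : Algebra ℝ D) (𝒟 : ZMod 2 → Submodule ℝ D)
    (_ : GradedAlgebra 𝒟), IsDivisionSuperalgebra 𝒟 ∧
      IsMatrixSuperalgebraOver 𝒜 𝒟 ∧ IsMatrixSuperalgebraOver ℬ 𝒟

/-! ### Clifford superalgebras -/

/-- The diagonal real quadratic form with `r` coefficients `+1` and `s` coefficients `-1`. -/
noncomputable def realForm (r s : ℕ) : QuadraticForm ℝ (Fin r ⊕ Fin s → ℝ) :=
  QuadraticMap.weightedSumSquares ℝ (Sum.elim (fun _ => (1 : ℝ)) (fun _ => (-1 : ℝ)))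

/-- The real Clifford superalgebra `Cl_{r,-s}`: `r` generators square to `+1`, `s` to `-1`.
So `Cl_r` is `realCl r 0` and `Cl_{-s}` is `realCl 0 s`. -/
noncomputable def realCl (r s : ℕ) (i : ZMod 2) : Submodule ℝ (CliffordAlgebra (realForm r s)) :=
  CliffordAlgebra.evenOdd (realForm r s) i

/-- The complex quadratic form `z₁² + ⋯ + zₙ²`. -/
noncomputable def complexForm (n : ℕ) : QuadraticForm ℂ (Fin n → ℂ) :=
  QuadraticMap.weightedSumSquares ℂ (fun _ : Fin n => (1 : ℂ))

/-- The complex Clifford superalgebra `ℂl_n`, as a real superalgebra. -/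
noncomputable def complexCl (n : ℕ) (i : ZMod 2) :
    Submodule ℝ (CliffordAlgebra (complexForm n)) :=
  (CliffordAlgebra.evenOdd (complexForm n) i).restrictScalars ℝ

/-! ### Graded groups and `φ`-representations -/

/-- An odd element of a graded group that commutes with every even element. -/
def IsTimeReversal {G : Type*} [Group G] (φ : G →* ℤˣ) (T : G) : Prop :=
  φ T = -1 ∧ ∀ g, φ g = 1 → T * g = g * T

/-- A graded topological group is factorizable if `φ` has a splitting `s` and, moreover, either
every (topological) automorphism of the even subgroup is inner, or the image of `s` is normal, so
that the group is the direct product of its even subgroup with `ℤ/2`. -/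
def IsFactorizable {G : Type*} [Group G] [TopologicalSpace G] (φ : G →* ℤˣ) : Prop :=
  ∃ s : ℤˣ →* G, (∀ ε, φ (s ε) = ε) ∧
    ((∀ α : φ.ker ≃ₜ* φ.ker, ∃ h : φ.ker, ∀ g, α g = h⁻¹ * g * h) ∨ s.range.Normal)

/-- A continuous `φ`-representation of the graded group `(G, φ)` on the real vector space `V`
with complex structure `I`: even elements act linearly and odd elements antilinearly. -/
structure PhiRep {G : Type*} [Group G] [TopologicalSpace G] (φ : G →* ℤˣ)
    (V : Type*) [NormedAddCommGroup V] [NormedSpace ℝ V] where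
  I : Module.End ℝ V
  I_mul_I : I * I = -1
  ρ : G →* Module.End ℝ V
  ρ_mul_I : ∀ g, ρ g * I = ((φ g : ℤˣ) : ℤ) • (I * ρ g)
  continuous_ρ : ∀ v, Continuous fun g => ρ g v

namespace PhiRep

variable {G : Type*} [Group G] [TopologicalSpace G] {φ : G →* ℤˣ}
  {V : Type*} [NormedAddCommGroup V] [NormedSpace ℝ V]

/-- Irreducibility: `V` is nonzero and has no `φ`-subrepresentations besides `0` and `V`. -/
def IsIrreducible (R : PhiRep φ V) : Prop :=
  Nontrivial V ∧ ∀ W : Submodule ℝ V, (∀ w ∈ W, R.I w ∈ W) → (∀ g, ∀ w ∈ W, R.ρ g w ∈ W) →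
    W = ⊥ ∨ W = ⊤

/-- The algebra `𝒜` generated by the operators of the even group elements. -/
def algA (R : PhiRep φ V) : Subalgebra ℝ (Module.End ℝ V) :=
  Algebra.adjoin ℝ {x | ∃ g, φ g = 1 ∧ x = R.ρ g}

/-- The algebra `ℬ` generated by `𝒜` and the complex structure. -/
def algB (R : PhiRep φ V) : Subalgebra ℝ (Module.End ℝ V) :=
  Algebra.adjoin ℝ (insert R.I {x | ∃ g, φ g = 1 ∧ x = R.ρ g})

/-- The algebra `𝒟` generated by the operators of all group elements and the complex structure. -/
def algD (R : PhiRep φ V) : Subalgebra ℝ (Module.End ℝ V) :=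
  Algebra.adjoin ℝ (insert R.I (Set.range R.ρ))

/-- The algebra underlying the group superalgebra `𝒜ₛ`, generated by the operators of all group
elements. -/
def algAs (R : PhiRep φ V) : Subalgebra ℝ (Module.End ℝ V) :=
  Algebra.adjoin ℝ (Set.range R.ρ)

/-- The grading of the group superalgebra `𝒜ₛ` inherited from the group: the even (odd) part is
the span of the operators of the even (odd) group elements. -/
def gradingAs (R : PhiRep φ V) (i : ZMod 2) : Submodule ℝ R.algAs :=
  (Submodule.span ℝ {x | ∃ g, φ g = (if i = 0 then 1 else -1) ∧ x = R.ρ g}).comap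
    R.algAs.val.toLinearMap

end PhiRep

/-! ### Dyson types -/

/-- The ten Dyson types; the first letter is the class of `𝒟`, the second one that of `𝒜`. -/
inductive DysonType where
  | RR | RC | RH | CR | CC1 | CC2 | CH | HR | HC | HH

/-- The full matrix algebra `K(n)`. -/
abbrev Mat (K : Type) (n : ℕ) : Type := Matrix (Fin n) (Fin n) K

/-- The Dyson triple `(𝒟, ℬ, 𝒜)` of the `φ`-representation is of the given type. The size
parameter `n` is the common matrix factor `ℝ(n)` by which similar triples may differ. -/
def PhiRep.HasDysonType {G : Type*} [Group G] [TopologicalSpace G] {φ : G →* ℤˣ}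
    {V : Type*} [NormedAddCommGroup V] [NormedSpace ℝ V] (R : PhiRep φ V) (t : DysonType) :
    Prop :=
  ∃ n : ℕ, 0 < n ∧
    match t with
    | .RR => Nonempty (R.algD ≃ₐ[ℝ] Mat ℝ (2 * n)) ∧ Nonempty (R.algB ≃ₐ[ℝ] Mat ℂ n) ∧
        Nonempty (R.algA ≃ₐ[ℝ] Mat ℝ n)
    | .RC => Nonempty (R.algD ≃ₐ[ℝ] Mat ℝ (2 * n)) ∧ Nonempty (R.algB ≃ₐ[ℝ] Mat ℂ n) ∧
        Nonempty (R.algA ≃ₐ[ℝ] Mat ℂ n)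
    | .RH => Nonempty (R.algD ≃ₐ[ℝ] Mat ℝ (4 * n)) ∧ Nonempty (R.algB ≃ₐ[ℝ] Mat ℂ (2 * n)) ∧
        Nonempty (R.algA ≃ₐ[ℝ] Mat ℍ[ℝ] n)
    | .CR => Nonempty (R.algD ≃ₐ[ℝ] Mat ℂ (2 * n)) ∧
        Nonempty (R.algB ≃ₐ[ℝ] Mat ℂ n × Mat ℂ n) ∧ Nonempty (R.algA ≃ₐ[ℝ] Mat ℝ n × Mat ℝ n)
    | .CC1 => Nonempty (R.algD ≃ₐ[ℝ] Mat ℂ (2 * n)) ∧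
        Nonempty (R.algB ≃ₐ[ℝ] Mat ℂ n × Mat ℂ n) ∧ Nonempty (R.algA ≃ₐ[ℝ] Mat ℂ n × Mat ℂ n)
    | .CC2 => Nonempty (R.algD ≃ₐ[ℝ] Mat ℂ (2 * n)) ∧
        Nonempty (R.algB ≃ₐ[ℝ] Mat ℂ n × Mat ℂ n) ∧ Nonempty (R.algA ≃ₐ[ℝ] Mat ℂ n)
    | .CH => Nonempty (R.algD ≃ₐ[ℝ] Mat ℂ (4 * n)) ∧
        Nonempty (R.algB ≃ₐ[ℝ] Mat ℂ (2 * n) × Mat ℂ (2 * n)) ∧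
        Nonempty (R.algA ≃ₐ[ℝ] Mat ℍ[ℝ] n × Mat ℍ[ℝ] n)
    | .HR => Nonempty (R.algD ≃ₐ[ℝ] Mat ℍ[ℝ] n) ∧ Nonempty (R.algB ≃ₐ[ℝ] Mat ℂ n) ∧
        Nonempty (R.algA ≃ₐ[ℝ] Mat ℝ n)
    | .HC => Nonempty (R.algD ≃ₐ[ℝ] Mat ℍ[ℝ] n) ∧ Nonempty (R.algB ≃ₐ[ℝ] Mat ℂ n) ∧
        Nonempty (R.algA ≃ₐ[ℝ] Mat ℂ n)
    | .HH => Nonempty (R.algD ≃ₐ[ℝ] Mat ℍ[ℝ] (2 * n)) ∧ Nonempty (R.algB ≃ₐ[ℝ] Mat ℂ (2 * n)) ∧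
        Nonempty (R.algA ≃ₐ[ℝ] Mat ℍ[ℝ] n)

/-!
Let `τ = ρ(T)`. The operators `I` and `τ` commute with the algebra `𝒜` of the even group elements
and anticommute with each other, and `𝒟` is generated by `𝒜`, `I` and `τ`.

The algebra `𝒜` is simple (`PhiRep.isSimpleRing_algA`): if `a` annihilates a simple
`𝒜`-submodule of `V`, then the vectors killed by `a 𝒜` form a nonzero `φ`-subrepresentation,
so `a = 0`, and every simple submodule is faithful. By the theorems of Wedderburn and Frobenius `𝒜` is therefore `ℝ(n)`, `ℂ(n)` or
`ℍ(n)`. The operator `τ ^ 2` lies in the center of `𝒜`. If the center is `ℝ`, compactness of `G`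
gives `τ ^ 2 = ±1`; if it is `ℂ`, then `τ` can be divided by a complex square root of `τ ^ 2`. In
both cases there is an odd operator `σ`, equal to `τ` up to a central unit of `𝒜`, with
`σ ^ 2 = ε = ±1` and `ε = 1` in the complex case (`PhiRep.IsNormalizedTimeReversal`).

The operators `I` and `σ` generate a quaternion algebra `Q` linearly disjoint from `𝒜`
(`quaternionTensorLift_injective`), so `𝒟 ≅ Q ⊗ 𝒜` and `ℬ ≅ ℂ ⊗ 𝒜`, with `Q ≅ ℝ(2)` for `ε = 1`
and `Q = ℍ` for `ε = -1`. This yields the five Dyson types. They are told apart by the simplicity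
of `𝒜`, by the centers of `𝒜` and `𝒟`, and by the fact that `ℝ(a)` and `ℍ(b)` are never isomorphic
(`PhiRep.HasDysonType.eq`).

The superalgebra `𝒜ₛ = 𝒜 ⊕ 𝒜 σ` arises from `𝒜 = K(n)` by adjoining a central odd element of
square `ε`. Such a superalgebra is determined by its even part and `ε`, and it is
`End(ℝ^{n|0}) ⊗̂ D`, where `D` is obtained in the same way from `K` (`IsOddExtension.superSimilar`). The Clifford
superalgebras in question are such `D`: their even part is `ℝ`, `ℂ` or `ℍ`, and the product of the
generators is central and odd.
-/

/-! ### Finite-dimensional real division algebras -/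

/-- An integral element of a real algebra without zero divisors is a real number or of the form
`a + b J` with `J ^ 2 = -1`, since irreducible real polynomials have degree at most two. -/
theorem exists_eq_real_or_add_smul_imaginary {K : Type*} [Ring K] [Algebra ℝ K] [IsDomain K]
    (x : K) (hx : IsIntegral ℝ x) :
    (∃ a : ℝ, x = algebraMap ℝ K a) ∨
      ∃ a b : ℝ, ∃ J : K, b ≠ 0 ∧ J * J = -1 ∧ x = algebraMap ℝ K a + b • J := by
  have hirr := minpoly.irreducible hx
  have hmon := minpoly.monic hx
  have hdeg := hirr.natDegree_le_two
  have hpos := minpoly.natDegree_pos hx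
  have hroot := minpoly.aeval ℝ x
  have hquad : ∃ p q : ℝ, x * x = p • x + algebraMap ℝ K q := by
    rcases (show (minpoly ℝ x).natDegree = 1 ∨ (minpoly ℝ x).natDegree = 2 by omega) with h | h
    · rw [hmon.as_sum, h] at hroot
      simp only [Finset.range_one, Finset.sum_singleton, pow_zero, mul_one, pow_one, map_add,
        Polynomial.aeval_X, Polynomial.aeval_C] at hroot
      generalize (minpoly ℝ x).coeff 0 = r at hroot
      refine ⟨-r, 0, ?_⟩
      rw [eq_neg_of_add_eq_zero_left hroot]
      simp [Algebra.smul_def]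
    · rw [hmon.as_sum, h] at hroot
      simp [Finset.sum_range_succ] at hroot
      refine ⟨-(minpoly ℝ x).coeff 1, -(minpoly ℝ x).coeff 0, ?_⟩
      rw [← pow_two, eq_neg_of_add_eq_zero_left hroot]
      simp [Algebra.smul_def]
  obtain ⟨p, q, h⟩ := hquad
  -- complete the square
  set y := x - algebraMap ℝ K (p / 2) with hy
  have hxy : x = algebraMap ℝ K (p / 2) + y := by simp [hy]
  have hyy : y * y = algebraMap ℝ K (p ^ 2 / 4 + q) := by
    have e : y * y = x * x - p • x + algebraMap ℝ K (p ^ 2 / 4) := by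
      have h1 : p • x = algebraMap ℝ K (p / 2) * x + x * algebraMap ℝ K (p / 2) := by
        rw [← Algebra.commutes, ← Algebra.smul_def, ← add_smul]; congr 1; ring
      have h2 : algebraMap ℝ K (p ^ 2 / 4) = algebraMap ℝ K (p / 2) * algebraMap ℝ K (p / 2) := by
        rw [← map_mul]; congr 1; ring
      rw [h1, h2, hy]; noncomm_ring
    rw [e, h, map_add]; abel
  set d := p ^ 2 / 4 + q
  rcases le_or_gt 0 d with hd | hd
  · left
    have : (y - algebraMap ℝ K (√d)) * (y + algebraMap ℝ K (√d)) = 0 := by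
      have hc := Algebra.commutes (√d) y
      have hs : algebraMap ℝ K (√d) * algebraMap ℝ K (√d) = algebraMap ℝ K d := by
        rw [← map_mul, Real.mul_self_sqrt hd]
      rw [sub_mul, mul_add, mul_add, hyy, hc, hs]; abel
    rcases mul_eq_zero.1 this with h' | h'
    · exact ⟨p / 2 + √d, by rw [hxy, map_add, sub_eq_zero.1 h']⟩
    · exact ⟨p / 2 - √d, by rw [hxy, map_sub, eq_neg_of_add_eq_zero_left h', sub_eq_add_neg]⟩
  · right
    have hs : √(-d) ≠ 0 := (Real.sqrt_pos.2 (by linarith)).ne'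
    refine ⟨p / 2, √(-d), (√(-d))⁻¹ • y, hs, ?_, ?_⟩
    · rw [smul_mul_smul_comm, hyy, ← mul_inv, Real.mul_self_sqrt (by linarith),
        Algebra.smul_def, ← map_mul]
      rw [show (-d)⁻¹ * d = -1 by rw [inv_neg, neg_mul, inv_mul_cancel₀ hd.ne]]
      simp
    · rw [smul_smul, mul_inv_cancel₀ hs, one_smul, hxy]

/-- If `i ^ 2 = -1` in a finite-dimensional real division algebra, then every element commuting
with `i` is a real combination of `1` and `i`. -/
theorem exists_eq_add_smul_of_commute {K : Type*} [DivisionRing K] [Algebra ℝ K]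
    [Module.Finite ℝ K] {i x : K} (hi : i * i = -1) (hx : Commute x i) :
    ∃ a b : ℝ, x = algebraMap ℝ K a + b • i := by
  rcases exists_eq_real_or_add_smul_imaginary x (Algebra.IsIntegral.isIntegral x) with
    ⟨a, rfl⟩ | ⟨a, b, J, hb, hJ, rfl⟩
  · exact ⟨a, 0, by simp⟩
  · have hJi : J * i = i * J := by
      have h := hx.eq
      rw [add_mul, mul_add, Algebra.commutes, smul_mul_assoc, mul_smul_comm] at h
      exact smul_right_injective K hb (add_left_cancel h)
    have : (J - i) * (J + i) = 0 := by
      rw [sub_mul, mul_add, mul_add, hJ, hi, hJi]; abel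
    rcases mul_eq_zero.1 this with h | h
    · exact ⟨a, b, by rw [sub_eq_zero.1 h]⟩
    · exact ⟨a, -b, by rw [eq_neg_of_add_eq_zero_left h, smul_neg, neg_smul]⟩

/-- The quaternion basis `1, i, j, i j` given by anticommuting elements `i`, `j` with `i ^ 2 = -1`
and `j ^ 2 = ε`. -/
def quaternionBasisOf {E : Type*} [Ring E] [Algebra ℝ E] {i j : E} {ε : ℝ} (hi : i * i = -1)
    (hj : j * j = algebraMap ℝ E ε) (hji : j * i = -(i * j)) :
    QuaternionAlgebra.Basis E (-1 : ℝ) 0 ε where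
  i := i
  j := j
  k := i * j
  i_mul_i := by simp [hi]
  j_mul_j := by rw [hj, Algebra.algebraMap_eq_smul_one]
  i_mul_j := rfl
  j_mul_i := by simp [hji]

/-- **Frobenius' theorem.** -/
theorem nonempty_algEquiv_real_or_complex_or_quaternion (K : Type*) [DivisionRing K] [Algebra ℝ K]
    [Module.Finite ℝ K] :
    Nonempty (K ≃ₐ[ℝ] ℝ) ∨ Nonempty (K ≃ₐ[ℝ] ℂ) ∨ Nonempty (K ≃ₐ[ℝ] ℍ[ℝ]) := by
  by_cases hreal : ∀ x : K, ∃ a : ℝ, x = algebraMap ℝ K a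
  · exact .inl ⟨(AlgEquiv.ofBijective (Algebra.ofId ℝ K)
      ⟨(algebraMap ℝ K).injective, fun x => (hreal x).imp fun _ h => h.symm⟩).symm⟩
  obtain ⟨i, hi⟩ : ∃ i : K, i * i = -1 := by
    obtain ⟨x, hx⟩ := not_forall.1 hreal
    obtain ⟨-, -, J, -, hJ, -⟩ := (exists_eq_real_or_add_smul_imaginary x
      (Algebra.IsIntegral.isIntegral x)).resolve_left hx
    exact ⟨J, hJ⟩
  right
  by_cases hcomm : ∀ x : K, Commute x i
  · refine .inl ⟨(AlgEquiv.ofBijective (Complex.lift ⟨i, hi⟩)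
      ⟨(Complex.lift ⟨i, hi⟩ : ℂ →ₐ[ℝ] K).toRingHom.injective, fun x => ?_⟩).symm⟩
    obtain ⟨a, b, rfl⟩ := exists_eq_add_smul_of_commute hi (hcomm x)
    exact ⟨⟨a, b⟩, by simp [Complex.liftAux_apply]⟩
  right
  have hii : ∀ z : K, z * i * i = -z := fun z => by rw [mul_assoc, hi]; simp
  obtain ⟨x, hx⟩ := not_forall.1 hcomm
  -- the component of `x` that anticommutes with `i`
  obtain ⟨y, hy⟩ : ∃ y, y = x + i * x * i := ⟨_, rfl⟩
  have hyi : y * i = -(i * y) := by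
    rw [hy]; simp only [add_mul, mul_add, hii, ← mul_assoc, hi]
    simp
  have hy0 : y ≠ 0 := by
    intro h0
    apply hx
    have h1 : y * i = x * i - i * x := by rw [hy]; simp only [add_mul, hii]; abel
    rw [h0, zero_mul] at h1
    exact sub_eq_zero.1 h1.symm
  have hanti : ∀ z w : K, z * i = -(i * z) → w * i = -(i * w) → Commute (z * w) i := by
    intro z w hz hw
    rw [commute_iff_eq, mul_assoc, hw, mul_neg, ← mul_assoc, hz]
    simp [mul_assoc]
  -- `y ^ 2` lies in `ℝ[i]`, and as it commutes with `y` it is real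
  obtain ⟨p, hp⟩ : ∃ p : ℝ, y * y = algebraMap ℝ K p := by
    obtain ⟨a, b, hab⟩ := exists_eq_add_smul_of_commute hi (hanti y y hyi hyi)
    have h1 : y * (y * y) = (y * y) * y := by noncomm_ring
    rw [hab, mul_add, add_mul, ← Algebra.commutes, mul_smul_comm, smul_mul_assoc, hyi] at h1
    have h2 : b • (-(i * y)) = b • (i * y) := add_left_cancel h1
    have h3 : (2 * b) • (i * y) = 0 := by
      rw [two_mul, add_smul]; nth_rewrite 1 [← h2]; simp
    have hi0 : i ≠ 0 := fun h => by simp [h] at hi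
    have hb : b = 0 := by simpa [hi0, hy0] using h3
    exact ⟨a, by rw [hab, hb]; simp⟩
  obtain ⟨j, hj, hji⟩ : ∃ j : K, j * j = -1 ∧ j * i = -(i * j) := by
    -- otherwise `y = ±√p` would commute with `i`
    have hpneg : p < 0 := by
      by_contra! hp0
      have : (y - algebraMap ℝ K (√p)) * (y + algebraMap ℝ K (√p)) = 0 := by
        have hc := Algebra.commutes (√p) y
        have hs : algebraMap ℝ K (√p) * algebraMap ℝ K (√p) = algebraMap ℝ K p := by
          rw [← map_mul, Real.mul_self_sqrt hp0]
        rw [sub_mul, mul_add, mul_add, hp, hc, hs]; abel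
      have hcy : y * i = i * y := by
        rcases mul_eq_zero.1 this with h' | h'
        · rw [sub_eq_zero.1 h', Algebra.commutes]
        · rw [eq_neg_of_add_eq_zero_left h', neg_mul, mul_neg, Algebra.commutes]
      rw [hyi] at hcy
      have h3 : (2 : ℝ) • (i * y) = 0 := by
        rw [two_smul]; nth_rewrite 1 [← hcy]; simp
      have hi0 : i ≠ 0 := fun h => by simp [h] at hi
      simp [hi0, hy0] at h3
    refine ⟨(√(-p))⁻¹ • y, ?_, ?_⟩
    · rw [smul_mul_smul_comm, hp, ← mul_inv, Real.mul_self_sqrt (by linarith),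
        Algebra.smul_def, ← map_mul]
      rw [show (-p)⁻¹ * p = -1 by rw [inv_neg, neg_mul, inv_mul_cancel₀ hpneg.ne]]
      simp
    · rw [smul_mul_assoc, hyi, mul_smul_comm, smul_neg]
  let q := quaternionBasisOf (ε := -1) hi (by simp [hj]) hji
  let f : ℍ[ℝ] →ₐ[ℝ] K := q.liftHom
  refine ⟨(AlgEquiv.ofBijective f ⟨f.toRingHom.injective, fun x => ?_⟩).symm⟩
  -- split `x` into parts commuting and anticommuting with `i`
  have hcp : Commute (x - i * x * i) i := by
    rw [commute_iff_eq]; simp only [sub_mul, mul_sub, hii, ← mul_assoc, hi]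
    simp [add_comm]
  have hcm : (x + i * x * i) * i = -(i * (x + i * x * i)) := by
    simp only [add_mul, mul_add, hii, ← mul_assoc, hi]
    simp
  obtain ⟨a, b, h1⟩ := exists_eq_add_smul_of_commute hi hcp
  obtain ⟨c, d, h2⟩ := exists_eq_add_smul_of_commute hi (hanti _ j hcm hji)
  refine ⟨⟨a / 2, b / 2, -(c / 2), -(d / 2)⟩, ?_⟩
  have h3 : x + i * x * i = -((algebraMap ℝ K c + d • i) * j) := by
    rw [← h2, mul_assoc _ j j, hj]; simp
  have h4 : x = (2⁻¹ : ℝ) • ((x - i * x * i) + (x + i * x * i)) := by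
    rw [sub_add_add_cancel, ← two_smul ℝ, smul_smul]; norm_num
  rw [h4, h1, h3]
  change q.lift _ = _
  simp only [QuaternionAlgebra.Basis.lift, q, quaternionBasisOf, Algebra.algebraMap_eq_smul_one,
    add_mul, smul_mul_assoc, one_mul, smul_add, smul_neg, smul_smul, neg_smul]
  simp only [div_eq_inv_mul]
  abel_nf

/-! ### Tensor products with quaternion algebras and with `ℂ` -/

theorem QuaternionAlgebra.Basis.commute_liftHom {E : Type*} [Ring E] [Algebra ℝ E]
    {c₁ c₂ c₃ : ℝ} (q : QuaternionAlgebra.Basis E c₁ c₂ c₃) {a : E} (hi : Commute a q.i)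
    (hj : Commute a q.j) (x : ℍ[ℝ,c₁,c₂,c₃]) : Commute (q.liftHom x) a := by
  have hk : Commute a q.k := q.i_mul_j ▸ hi.mul_right hj
  change Commute (q.lift x) a
  have h1 : Commute (algebraMap ℝ E x.re) a := Algebra.commutes _ a
  exact ((h1.add_left (hi.symm.smul_left _)).add_left (hj.symm.smul_left _)).add_left
    (hk.symm.smul_left _)

theorem exists_eq_tmul_quaternion {A : Type*} [Ring A] [Algebra ℝ A] {ε : ℝ}
    (z : ℍ[ℝ,-1,0,ε] ⊗[ℝ] A) : ∃ a b c d : A, z = (1 : ℍ[ℝ,-1,0,ε]) ⊗ₜ[ℝ] a +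
      (⟨0, 1, 0, 0⟩ : ℍ[ℝ,-1,0,ε]) ⊗ₜ[ℝ] b + (⟨0, 0, 1, 0⟩ : ℍ[ℝ,-1,0,ε]) ⊗ₜ[ℝ] c +
      (⟨0, 0, 0, 1⟩ : ℍ[ℝ,-1,0,ε]) ⊗ₜ[ℝ] d := by
  induction z using TensorProduct.induction_on with
  | zero => exact ⟨0, 0, 0, 0, by simp⟩
  | tmul x y =>
    refine ⟨x.re • y, x.imI • y, x.imJ • y, x.imK • y, ?_⟩
    simp only [TensorProduct.tmul_smul, TensorProduct.smul_tmul', ← TensorProduct.add_tmul]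
    congr 1
    ext <;> simp
  | add x y hx hy =>
    obtain ⟨a, b, c, d, rfl⟩ := hx
    obtain ⟨a', b', c', d', rfl⟩ := hy
    refine ⟨a + a', b + b', c + c', d + d', ?_⟩
    simp only [TensorProduct.tmul_add]
    abel

theorem exists_eq_tmul_complex {A : Type*} [Ring A] [Algebra ℝ A]
    (z : ℂ ⊗[ℝ] A) : ∃ a b : A, z = (1 : ℂ) ⊗ₜ[ℝ] a + Complex.I ⊗ₜ[ℝ] b := by
  induction z using TensorProduct.induction_on with
  | zero => exact ⟨0, 0, by simp⟩
  | tmul x y =>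
    refine ⟨x.re • y, x.im • y, ?_⟩
    simp only [TensorProduct.tmul_smul, TensorProduct.smul_tmul', ← TensorProduct.add_tmul]
    congr 1
    apply Complex.ext <;> simp
  | add x y hx hy =>
    obtain ⟨a, b, rfl⟩ := hx
    obtain ⟨a', b', rfl⟩ := hy
    refine ⟨a + a', b + b', ?_⟩
    simp only [TensorProduct.tmul_add]
    abel

section Disjoint

variable {E A : Type*} [Ring E] [Algebra ℝ E] [Ring A] [Algebra ℝ A] {i j : E} {ε : ℝ}

/-- Conjugation by `j` separates the two components of `a + i b`. -/
theorem eq_zero_of_add_mul_eq_zero (hε : ε ≠ 0) (hi : i * i = -1) (hj : j * j = algebraMap ℝ E ε)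
    (hji : j * i = -(i * j)) {a b : E} (ha : Commute a j) (hb : Commute b j)
    (h : a + i * b = 0) : a = 0 ∧ b = 0 := by
  have h1 : j * (a + i * b) * j = ε • (a - i * b) := by
    have e1 : j * a * j = ε • a := by
      rw [← ha.eq, mul_assoc, hj, ← Algebra.commutes, Algebra.smul_def]
    have e2 : j * (i * b) * j = -(ε • (i * b)) := by
      rw [← mul_assoc, hji, neg_mul, neg_mul, mul_assoc, mul_assoc, hb.eq, ← mul_assoc j, hj,
        ← Algebra.smul_def, mul_smul_comm]
    rw [mul_add, add_mul, e1, e2, smul_sub, sub_eq_add_neg]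
  rw [h, mul_zero, zero_mul] at h1
  have h2 : a - i * b = 0 := by simpa [hε] using h1.symm
  have h3 : i * b = 0 := by
    have : (2 : ℝ) • (i * b) = 0 := by
      rw [two_smul]; calc _ = (a + i * b) - (a - i * b) := by abel
        _ = 0 := by rw [h, h2, sub_zero]
    simpa using this
  refine ⟨by simpa [h3] using h, ?_⟩
  have h4 : i * (i * b) = -b := by rw [← mul_assoc, hi]; simp
  rw [h3, mul_zero] at h4
  exact neg_eq_zero.1 h4.symm

/-- A pair of anticommuting elements `i`, `j` with `i ^ 2 = -1`, `j ^ 2 = ε ≠ 0` is linearly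
disjoint from every algebra commuting with it. -/
theorem quaternionTensorLift_injective (hε : ε ≠ 0) (hi : i * i = -1)
    (hj : j * j = algebraMap ℝ E ε) (hji : j * i = -(i * j)) (g : A →ₐ[ℝ] E)
    (hg : Function.Injective g) (hgi : ∀ a, Commute (g a) i) (hgj : ∀ a, Commute (g a) j) :
    Function.Injective (Algebra.TensorProduct.lift (quaternionBasisOf hi hj hji).liftHom g
      fun x a => (quaternionBasisOf hi hj hji).commute_liftHom (hgi a) (hgj a) x) := by
  rw [injective_iff_map_eq_zero]
  intro z hz
  obtain ⟨a, b, c, d, rfl⟩ := exists_eq_tmul_quaternion z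
  have h : (g a + i * g b) + j * (g c - i * g d) = 0 := by
    have e : i * j * g d = -(j * (i * g d)) := by rw [← mul_assoc, hji]; simp
    rw [← hz]
    simp only [map_add, Algebra.TensorProduct.lift_tmul]
    simp [QuaternionAlgebra.Basis.liftHom, QuaternionAlgebra.Basis.lift, quaternionBasisOf, mul_sub,
      e]
    abel
  have comm2 : ∀ x y, Commute (g x + i * g y) i := fun x y =>
    (hgi x).add_left ((Commute.refl i).mul_left (hgi y))
  -- conjugation by `i` separates the part commuting with `i` from the anticommuting one
  have h1 : i * ((g a + i * g b) + j * (g c - i * g d)) * i =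
      -(g a + i * g b) + j * (g c - i * g d) := by
    have e1 := (comm2 a b).eq
    have e2 := (comm2 c (-d)).eq
    simp only [map_neg, mul_neg, ← sub_eq_add_neg] at e2
    rw [mul_add, add_mul, ← e1, mul_assoc, hi, mul_assoc i (j * _), mul_assoc j, e2, ← mul_assoc j,
      hji]
    simp only [neg_mul, mul_neg, mul_one, ← mul_assoc, hi, one_mul, neg_neg]
  rw [h, mul_zero, zero_mul] at h1
  have hP : g a + i * g b = 0 := by
    have : (2 : ℝ) • (g a + i * g b) = 0 := by
      rw [two_smul]
      calc _ = ((g a + i * g b) + j * (g c - i * g d)) -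
            (-(g a + i * g b) + j * (g c - i * g d)) := by abel
        _ = 0 := by rw [h, ← h1, sub_zero]
    exact (smul_eq_zero.1 this).resolve_left two_ne_zero
  have hQ : g c + i * g (-d) = 0 := by
    rw [hP, zero_add] at h
    have h2 : j * (j * (g c - i * g d)) = 0 := by rw [h, mul_zero]
    rw [← mul_assoc, hj, ← Algebra.smul_def] at h2
    simpa [sub_eq_add_neg] using (smul_eq_zero.1 h2).resolve_left hε
  obtain ⟨ha, hb⟩ := eq_zero_of_add_mul_eq_zero hε hi hj hji (hgj a) (hgj b) hP
  obtain ⟨hc, hd⟩ := eq_zero_of_add_mul_eq_zero hε hi hj hji (hgj c) (hgj _) hQ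
  have h0 : ∀ x, g x = 0 → x = 0 := (injective_iff_map_eq_zero g).1 hg
  rw [h0 _ ha, h0 _ hb, h0 _ hc, neg_eq_zero.1 (h0 _ hd)]
  simp

theorem commute_complexLift (hi : i * i = -1) {a : E} (ha : Commute a i) (z : ℂ) :
    Commute (Complex.lift ⟨i, hi⟩ z) a := by
  have h1 : Commute (algebraMap ℝ E z.re) a := Algebra.commutes _ a
  exact h1.add_left (ha.symm.smul_left _)

theorem complexTensorLift_injective (hε : ε ≠ 0) (hi : i * i = -1)
    (hj : j * j = algebraMap ℝ E ε) (hji : j * i = -(i * j)) (g : A →ₐ[ℝ] E)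
    (hg : Function.Injective g) (hgi : ∀ a, Commute (g a) i) (hgj : ∀ a, Commute (g a) j) :
    Function.Injective (Algebra.TensorProduct.lift (Complex.lift ⟨i, hi⟩) g
      fun x a => commute_complexLift hi (hgi a) x) := by
  rw [injective_iff_map_eq_zero]
  intro z hz
  obtain ⟨a, b, rfl⟩ := exists_eq_tmul_complex z
  obtain ⟨ha, hb⟩ := eq_zero_of_add_mul_eq_zero hε hi hj hji (hgj a) (hgj b)
    (by simpa [Complex.liftAux_apply] using hz)
  have h0 : ∀ x, g x = 0 → x = 0 := (injective_iff_map_eq_zero g).1 hg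
  rw [h0 _ ha, h0 _ hb]
  simp

end Disjoint

theorem Algebra.TensorProduct.range_lift_eq {X Y E : Type*} [Ring X] [Algebra ℝ X] [Ring Y]
    [Algebra ℝ Y] [Ring E] [Algebra ℝ E] (f : X →ₐ[ℝ] E) (g : Y →ₐ[ℝ] E)
    (h : ∀ x y, Commute (f x) (g y)) :
    (Algebra.TensorProduct.lift f g h).range = f.range ⊔ g.range := by
  apply le_antisymm
  · rintro _ ⟨z, rfl⟩
    change Algebra.TensorProduct.lift f g h z ∈ _
    induction z using TensorProduct.induction_on with
    | zero => rw [map_zero]; exact zero_mem _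
    | tmul x y =>
      rw [Algebra.TensorProduct.lift_tmul]
      exact mul_mem ((le_sup_left : f.range ≤ _) ⟨x, rfl⟩)
        ((le_sup_right : g.range ≤ _) ⟨y, rfl⟩)
    | add x y hx hy => rw [map_add]; exact add_mem hx hy
  · refine sup_le ?_ ?_
    · rintro _ ⟨x, rfl⟩
      exact ⟨x ⊗ₜ 1, by simp⟩
    · rintro _ ⟨x, rfl⟩
      exact ⟨1 ⊗ₜ x, by simp⟩

theorem AlgHom.nonempty_algEquiv_of_range_eq {X E : Type*} [Ring X] [Algebra ℝ X] [Ring E]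
    [Algebra ℝ E] (f : X →ₐ[ℝ] E) (hf : Function.Injective f) {S : Subalgebra ℝ E}
    (h : f.range = S) : Nonempty (S ≃ₐ[ℝ] X) := by
  subst h
  exact ⟨(AlgEquiv.ofInjective f hf).symm⟩

/-! ### The concrete tensor products -/

theorem nonempty_algEquiv_of_injective_of_finrank_eq {X Y : Type*} [Ring X] [Algebra ℝ X]
    [Ring Y] [Algebra ℝ Y] [Module.Finite ℝ X] [Module.Finite ℝ Y] (f : X →ₐ[ℝ] Y)
    (hf : Function.Injective f) (h : Module.finrank ℝ X = Module.finrank ℝ Y) :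
    Nonempty (X ≃ₐ[ℝ] Y) :=
  ⟨AlgEquiv.ofBijective f
    ⟨hf, (LinearMap.injective_iff_surjective_of_finrank_eq_finrank (f := f.toLinearMap) h).1 hf⟩⟩

theorem nonempty_splitQuaternion_algEquiv : Nonempty (ℍ[ℝ,-1,0,1] ≃ₐ[ℝ] Mat ℝ 2) := by
  have hi : !![0, -1; 1, 0] * !![0, -1; 1, 0] = (-1 : Mat ℝ 2) := by
    ext a b; fin_cases a <;> fin_cases b <;> simp
  have hj : !![1, 0; 0, -1] * !![1, 0; 0, -1] = algebraMap ℝ (Mat ℝ 2) 1 := by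
    ext a b; fin_cases a <;> fin_cases b <;> simp
  have hji : !![1, 0; 0, -1] * !![0, -1; 1, 0] =
      -(!![0, -1; 1, 0] * !![1, 0; 0, -1] : Mat ℝ 2) := by
    ext a b; fin_cases a <;> fin_cases b <;> simp
  have := quaternionTensorLift_injective one_ne_zero hi hj hji (Algebra.ofId ℝ (Mat ℝ 2))
    (algebraMap ℝ (Mat ℝ 2)).injective (fun a => Algebra.commutes a _)
    (fun a => Algebra.commutes a _)
  obtain ⟨e⟩ := nonempty_algEquiv_of_injective_of_finrank_eq _ this
    (by simp [Module.finrank_matrix, QuaternionAlgebra.finrank_eq_four])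
  exact ⟨(Algebra.TensorProduct.rid ℝ ℝ _).symm.trans e⟩

theorem nonempty_quaternion_tensor_complex_algEquiv :
    Nonempty (ℍ[ℝ] ⊗[ℝ] ℂ ≃ₐ[ℝ] Mat ℂ 2) := by
  have hi : !![Complex.I, 0; 0, -Complex.I] * !![Complex.I, 0; 0, -Complex.I] = (-1 : Mat ℂ 2) := by
    ext a b; fin_cases a <;> fin_cases b <;> simp
  have hj : !![0, 1; -1, 0] * !![0, 1; -1, 0] = algebraMap ℝ (Mat ℂ 2) (-1) := by
    ext a b; fin_cases a <;> fin_cases b <;> simp [Algebra.algebraMap_eq_smul_one]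
  have hji : !![0, 1; -1, 0] * !![Complex.I, 0; 0, -Complex.I] =
      -(!![Complex.I, 0; 0, -Complex.I] * !![0, 1; -1, 0] : Mat ℂ 2) := by
    ext a b; fin_cases a <;> fin_cases b <;> simp
  have := quaternionTensorLift_injective (by norm_num) hi hj hji
    ((Algebra.ofId ℂ (Mat ℂ 2)).restrictScalars ℝ)
    (algebraMap ℂ (Mat ℂ 2)).injective (fun a => Algebra.commutes a _)
    (fun a => Algebra.commutes a _)
  exact nonempty_algEquiv_of_injective_of_finrank_eq _ this
    (by simp [Module.finrank_matrix, QuaternionAlgebra.finrank_eq_four])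

theorem nonempty_complex_tensor_quaternion_algEquiv :
    Nonempty (ℂ ⊗[ℝ] ℍ[ℝ] ≃ₐ[ℝ] Mat ℂ 2) :=
  nonempty_quaternion_tensor_complex_algEquiv.map (Algebra.TensorProduct.comm ℝ ℂ ℍ[ℝ]).trans

theorem nonempty_quaternion_tensor_quaternion_algEquiv :
    Nonempty (ℍ[ℝ] ⊗[ℝ] ℍ[ℝ] ≃ₐ[ℝ] Mat ℝ 4) := by
  let L := Algebra.lmul ℝ ℍ[ℝ]
  -- right multiplication, turned into a homomorphism by quaternionic conjugation
  let R : ℍ[ℝ] →ₐ[ℝ] Module.End ℝ ℍ[ℝ] :=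
    { toFun := fun a => LinearMap.mulRight ℝ (star a)
      map_one' := by ext1; simp
      map_mul' := fun a b => by ext1; simp [mul_assoc]
      map_zero' := by ext1; simp
      map_add' := fun a b => by ext1; simp [mul_add]
      commutes' := fun r => by
        ext1 x
        simpa [Algebra.smul_def] using (Algebra.commutes r x).symm }
  have hLR : ∀ a b, Commute (R a) (L b) := fun a b => LinearMap.ext fun x => by
    simp [R, L, mul_assoc]
  let i : ℍ[ℝ] := ⟨0, 1, 0, 0⟩
  let j : ℍ[ℝ] := ⟨0, 0, 1, 0⟩
  have hi : L i * L i = -1 := by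
    rw [← map_mul, ← map_one L, ← map_neg]; congr 1
    ext <;> simp only [Quaternion.re_mul, Quaternion.imI_mul, Quaternion.imJ_mul,
      Quaternion.imK_mul] <;> simp [i]
  have hj : L j * L j = algebraMap ℝ _ (-1) := by
    rw [← map_mul, ← AlgHom.commutes L]; congr 1
    ext <;> simp only [Quaternion.re_mul, Quaternion.imI_mul, Quaternion.imJ_mul,
      Quaternion.imK_mul] <;> simp [j]
  have hji : L j * L i = -(L i * L j) := by
    rw [← map_mul, ← map_mul, ← map_neg]; congr 1
    ext <;> simp only [Quaternion.re_neg, Quaternion.imI_neg, Quaternion.imJ_neg,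
      Quaternion.imK_neg, Quaternion.re_mul, Quaternion.imI_mul, Quaternion.imJ_mul,
      Quaternion.imK_mul] <;> simp [i, j]
  have hR : Function.Injective R := R.toRingHom.injective
  have := quaternionTensorLift_injective (by norm_num) hi hj hji R hR
    (fun a => hLR a _) (fun a => hLR a _)
  obtain ⟨e⟩ := nonempty_algEquiv_of_injective_of_finrank_eq _ this
    (by simp [QuaternionAlgebra.finrank_eq_four, Module.finrank_linearMap,
      Quaternion.finrank_eq_four])
  exact ⟨e.trans (algEquivMatrix (QuaternionAlgebra.basisOneIJK _ _ _))⟩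

theorem nonempty_complex_tensor_complex_algEquiv : Nonempty (ℂ ⊗[ℝ] ℂ ≃ₐ[ℝ] ℂ × ℂ) := by
  refine nonempty_algEquiv_of_injective_of_finrank_eq (Algebra.TensorProduct.lift
    ((AlgHom.id ℝ ℂ).prod (AlgHom.id ℝ ℂ)) ((AlgHom.id ℝ ℂ).prod Complex.conjAe.toAlgHom)
    fun _ _ => Commute.all _ _) ?_ (by simp)
  rw [injective_iff_map_eq_zero]
  intro z hz
  obtain ⟨a, b, rfl⟩ := exists_eq_tmul_complex z
  simp [Prod.ext_iff, Complex.ext_iff] at hz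
  obtain ⟨⟨h1, h2⟩, h3, h4⟩ := hz
  have ha : a = 0 := Complex.ext (by simp; linarith) (by simp; linarith)
  have hb : b = 0 := Complex.ext (by simp; linarith) (by simp; linarith)
  simp [ha, hb]

/-! ### Matrix algebras over tensor products -/

theorem nonempty_tensor_matrix_algEquiv (Q K : Type*) [Ring Q] [Algebra ℝ Q] [Ring K] [Algebra ℝ K]
    (n : ℕ) : Nonempty (Q ⊗[ℝ] Matrix (Fin n) (Fin n) K ≃ₐ[ℝ] Matrix (Fin n) (Fin n) (Q ⊗[ℝ] K)) :=
  ⟨((Algebra.TensorProduct.congr AlgEquiv.refl (matrixEquivTensor (Fin n) ℝ K)).trans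
    (Algebra.TensorProduct.assoc ℝ ℝ ℝ Q K _).symm).trans
      (matrixEquivTensor (Fin n) ℝ (Q ⊗[ℝ] K)).symm⟩

theorem nonempty_matrix_matrix_algEquiv (K : Type*) [Ring K] [Algebra ℝ K] (m n : ℕ) :
    Nonempty (Matrix (Fin n) (Fin n) (Matrix (Fin m) (Fin m) K) ≃ₐ[ℝ]
      Matrix (Fin (m * n)) (Fin (m * n)) K) :=
  ⟨(Matrix.compAlgEquiv (Fin n) (Fin m) K ℝ).trans
    (Matrix.reindexAlgEquiv ℝ K (finProdFinEquiv.trans (finCongr (mul_comm n m))))⟩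

/-! ### Superalgebras with a central odd unit -/

/-- The superalgebra `𝒳` arises from the purely even algebra `K` by adjoining a central odd element
`u` with `u ^ 2 = ε`: the even part is a copy of `K` and the odd part is `K u`. -/
def IsOddExtension (K : Type*) [Ring K] [Algebra ℝ K] (ε : ℝ) {X : Type*} [Ring X] [Algebra ℝ X]
    (𝒳 : ZMod 2 → Submodule ℝ X) : Prop :=
  ∃ (g : K →ₐ[ℝ] X) (u : X), Function.Injective g ∧ (∀ x, x ∈ 𝒳 0 ↔ ∃ k, g k = x) ∧
    (∀ x, x ∈ 𝒳 1 ↔ ∃ k, g k * u = x) ∧ (∀ x, Commute u x) ∧ u * u = algebraMap ℝ X ε ∧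
    IsCompl (𝒳 0) (𝒳 1)

section OddExtension

variable {K : Type*} [Ring K] [Algebra ℝ K] {ε : ℝ} {X : Type*} [Ring X] [Algebra ℝ X]
  {𝒳 : ZMod 2 → Submodule ℝ X} {Y : Type*} [Ring Y] [Algebra ℝ Y]
  {𝒴 : ZMod 2 → Submodule ℝ Y}

theorem SuperIso.symm (h : SuperIso 𝒳 𝒴) : SuperIso 𝒴 𝒳 := by
  obtain ⟨f, hf⟩ := h
  refine ⟨f.symm, fun i => ?_⟩
  ext x
  simp [← hf i]

theorem SuperIso.trans {Z : Type*} [Ring Z] [Algebra ℝ Z] {𝒵 : ZMod 2 → Submodule ℝ Z}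
    (h : SuperIso 𝒳 𝒴) (h' : SuperIso 𝒴 𝒵) : SuperIso 𝒳 𝒵 := by
  obtain ⟨f, hf⟩ := h
  obtain ⟨f', hf'⟩ := h'
  refine ⟨f.trans f', fun i => ?_⟩
  rw [← hf', ← hf, ← Submodule.map_comp]
  rfl

theorem IsOddExtension.congr {K' : Type*} [Ring K'] [Algebra ℝ K'] (e : K' ≃ₐ[ℝ] K)
    (h : IsOddExtension K ε 𝒳) : IsOddExtension K' ε 𝒳 := by
  obtain ⟨g, u, hg, h0, h1, hu, huu, hc⟩ := h
  refine ⟨g.comp e.toAlgHom, u, hg.comp e.injective, fun x => (h0 x).trans ?_,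
    fun x => (h1 x).trans ?_, hu, huu, hc⟩
  · exact ⟨fun ⟨k, hk⟩ => ⟨e.symm k, by simpa using hk⟩, fun ⟨k, hk⟩ => ⟨e k, hk⟩⟩
  · exact ⟨fun ⟨k, hk⟩ => ⟨e.symm k, by simpa using hk⟩, fun ⟨k, hk⟩ => ⟨e k, hk⟩⟩

/-- Coordinates on an odd extension, with its multiplication table. -/
theorem IsOddExtension.exists_linearEquiv (hε : ε ≠ 0) (hX : IsOddExtension K ε 𝒳) :
    ∃ L : (K × K) ≃ₗ[ℝ] X, L (1, 0) = 1 ∧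
      (∀ a b c d, L (a, b) * L (c, d) = L (a * c + ε • (b * d), a * d + b * c)) ∧
      (∀ x, x ∈ 𝒳 0 ↔ ∃ k, L (k, 0) = x) ∧ (∀ x, x ∈ 𝒳 1 ↔ ∃ k, L (0, k) = x) := by
  obtain ⟨g, u, hg, h0, h1, hu, huu, hc⟩ := hX
  let L : (K × K) →ₗ[ℝ] X :=
    g.toLinearMap.coprod ((LinearMap.mulRight ℝ u).comp g.toLinearMap)
  have hL : ∀ a b, L (a, b) = g a + g b * u := fun a b => rfl
  have hinj : Function.Injective L := by
    rw [injective_iff_map_eq_zero]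
    rintro ⟨a, b⟩ hab
    rw [hL] at hab
    have h2 : g a ∈ 𝒳 0 ⊓ 𝒳 1 :=
      ⟨(h0 _).2 ⟨a, rfl⟩, (h1 _).2 ⟨-b, by rw [eq_neg_of_add_eq_zero_left hab]; simp⟩⟩
    rw [hc.inf_eq_bot, Submodule.mem_bot] at h2
    rw [h2, zero_add] at hab
    have h3 : g b * u * u = 0 := by rw [hab, zero_mul]
    rw [mul_assoc, huu, ← Algebra.commutes, ← Algebra.smul_def, smul_eq_zero_iff_right hε] at h3
    rw [(injective_iff_map_eq_zero g).1 hg a h2, (injective_iff_map_eq_zero g).1 hg b h3]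
    rfl
  have hsurj : Function.Surjective L := fun x => by
    obtain ⟨y, hy, z, hz, rfl⟩ := Submodule.mem_sup.1
      (hc.sup_eq_top.symm ▸ Submodule.mem_top : x ∈ 𝒳 0 ⊔ 𝒳 1)
    obtain ⟨a, rfl⟩ := (h0 y).1 hy
    obtain ⟨b, rfl⟩ := (h1 z).1 hz
    exact ⟨(a, b), rfl⟩
  obtain ⟨L', hL'⟩ : ∃ L' : (K × K) ≃ₗ[ℝ] X, ∀ a b, L' (a, b) = g a + g b * u :=
    ⟨LinearEquiv.ofBijective L ⟨hinj, hsurj⟩, hL⟩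
  refine ⟨L', by simp [hL'], fun a b c d => ?_, ?_, ?_⟩
  · simp only [hL', map_add, map_mul, map_smul]
    have e1 : g b * u * (g d * u) = ε • (g b * g d) := by
      rw [mul_assoc, ← mul_assoc u, (hu (g d)).eq, mul_assoc, huu, ← Algebra.commutes,
        ← Algebra.smul_def, mul_smul_comm]
    have e2 : g b * u * g c = g b * g c * u := by rw [mul_assoc, (hu (g c)).eq, mul_assoc]
    rw [add_mul, mul_add, mul_add, e1, e2, add_mul, mul_assoc (g a)]
    abel
  · simpa [hL'] using h0
  · simpa [hL'] using h1

/-- An odd extension is determined by its even part and the square of the central odd element. -/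
theorem IsOddExtension.superIso (hε : ε ≠ 0) (hX : IsOddExtension K ε 𝒳)
    (hY : IsOddExtension K ε 𝒴) : SuperIso 𝒳 𝒴 := by
  obtain ⟨L, L1, Lm, L0, Lo⟩ := hX.exists_linearEquiv hε
  obtain ⟨M, M1, Mm, M0, Mo⟩ := hY.exists_linearEquiv hε
  refine ⟨AlgEquiv.ofLinearEquiv (L.symm.trans M) ?_ ?_, fun i => ?_⟩
  · simp [← L1, M1]
  · intro x y
    obtain ⟨⟨a, b⟩, rfl⟩ := L.surjective x
    obtain ⟨⟨c, d⟩, rfl⟩ := L.surjective y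
    simp [Lm, Mm]
  · ext y
    fin_cases i
    · rw [Submodule.mem_map]
      refine Iff.trans ⟨?_, ?_⟩ (M0 y).symm
      · rintro ⟨x, hx, rfl⟩
        obtain ⟨k, rfl⟩ := (L0 x).1 hx
        exact ⟨k, by simp⟩
      · rintro ⟨k, rfl⟩
        exact ⟨L (k, 0), (L0 _).2 ⟨k, rfl⟩, by simp⟩
    · rw [Submodule.mem_map]
      refine Iff.trans ⟨?_, ?_⟩ (Mo y).symm
      · rintro ⟨x, hx, rfl⟩
        obtain ⟨k, rfl⟩ := (Lo x).1 hx
        exact ⟨k, by simp⟩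
      · rintro ⟨k, rfl⟩
        exact ⟨L (0, k), (Lo _).2 ⟨k, rfl⟩, by simp⟩

/-- The grading of a matrix algebra over a superalgebra by the degree of the entries. -/
def matrixGrading (n : ℕ) (𝒳 : ZMod 2 → Submodule ℝ X) (i : ZMod 2) :
    Submodule ℝ (Matrix (Fin n) (Fin n) X) where
  carrier := {M | ∀ a b, M a b ∈ 𝒳 i}
  add_mem' := fun hx hy a b => add_mem (hx a b) (hy a b)
  zero_mem' := fun _ _ => zero_mem _
  smul_mem' := fun c _ hx a b => Submodule.smul_mem _ c (hx a b)

theorem IsOddExtension.matrix (n : ℕ) (h : IsOddExtension K ε 𝒳) :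
    IsOddExtension (Matrix (Fin n) (Fin n) K) ε (matrixGrading n 𝒳) := by
  obtain ⟨g, u, hg, h0, h1, hu, huu, hc⟩ := h
  refine ⟨g.mapMatrix, Matrix.scalar (Fin n) u, ?_, fun M => ⟨fun h => ?_, ?_⟩,
    fun M => ⟨fun h => ?_, ?_⟩, fun M => Matrix.scalar_commute u hu M, ?_, ?_, ?_⟩
  · intro M N h
    ext a b
    exact hg (congrFun (congrFun h a) b)
  · choose k hk using fun a b => (h0 _).1 (h a b)
    exact ⟨Matrix.of k, Matrix.ext hk⟩
  · rintro ⟨k, rfl⟩ a b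
    exact (h0 _).2 ⟨k a b, rfl⟩
  · choose k hk using fun a b => (h1 _).1 (h a b)
    exact ⟨Matrix.of k, Matrix.ext fun a b => by simpa using hk a b⟩
  · rintro ⟨k, rfl⟩ a b
    exact (h1 _).2 ⟨k a b, by simp⟩
  · rw [← map_mul, huu]
    rfl
  · rw [Submodule.disjoint_def]
    intro M hM hM'
    ext a b
    exact Submodule.disjoint_def.1 hc.disjoint _ (hM a b) (hM' a b)
  · rw [codisjoint_iff, eq_top_iff]
    intro M _
    choose y hy z hz hyz using fun a b => Submodule.mem_sup.1
        (hc.sup_eq_top.symm ▸ Submodule.mem_top : M a b ∈ 𝒳 0 ⊔ 𝒳 1)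
    exact Submodule.mem_sup.2 ⟨Matrix.of y, hy, Matrix.of z, hz, Matrix.ext hyz⟩

end OddExtension

/-! ### Purely even matrix superalgebras -/

section MatrixSuperalgebra

variable {D : Type*} [Ring D] [Algebra ℝ D] (𝒟 : ZMod 2 → Submodule ℝ D) [GradedAlgebra 𝒟]

theorem eq_zero_of_mem_superEnd_zero_right {n : ℕ} {M : Matrix (Fin n ⊕ Fin 0) (Fin n ⊕ Fin 0) ℝ}
    (h : M ∈ superEnd n 0 1) : M = 0 := by
  ext a b
  refine h a b ?_
  rcases a with a | a
  · rcases b with b | b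
    · simp [basisParity]
    · exact b.elim0
  · exact a.elim0

theorem mem_superEnd_zero_right {n : ℕ} (M : Matrix (Fin n ⊕ Fin 0) (Fin n ⊕ Fin 0) ℝ) :
    M ∈ superEnd n 0 0 := by
  intro a b h
  rcases a with a | a
  · rcases b with b | b
    · simp [basisParity] at h
    · exact b.elim0
  · exact a.elim0

/-- For the purely even superspace `ℝ^{n|0}`, no signs occur in `End(ℝ^{n|0}) ⊗̂ D`, which is thus
the algebra of matrices over `D`. -/
theorem superIso_tensorGrading_matrixGrading (n : ℕ) :
    SuperIso (tensorGrading (superEnd n 0) 𝒟) (matrixGrading n 𝒟) := by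
  let f : Matrix (Fin n ⊕ Fin 0) (Fin n ⊕ Fin 0) ℝ →ₐ[ℝ] Matrix (Fin n) (Fin n) D :=
    (Algebra.ofId ℝ D).mapMatrix.comp
      (Matrix.reindexAlgEquiv ℝ ℝ (Equiv.sumEmpty (Fin n) (Fin 0))).toAlgHom
  let g : D →ₐ[ℝ] Matrix (Fin n) (Fin n) D := Matrix.scalarAlgHom (Fin n) ℝ
  have hfg : ∀ (M : Matrix (Fin n ⊕ Fin 0) (Fin n ⊕ Fin 0) ℝ) (d : D) (a b : Fin n),
      (f M * g d) a b = M (.inl a) (.inl b) • d := fun M d a b => by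
    simp [f, g, Matrix.scalarAlgHom, Algebra.ofId_apply, Algebra.smul_def]
  let F := GradedTensorProduct.lift (superEnd n 0) 𝒟 f g (fun i j a b => by
    fin_cases i
    · have : Commute (g b) (f a) := by
        ext p q
        simp [f, g, Matrix.scalarAlgHom, Algebra.ofId_apply, Algebra.commutes]
      change f a * g b = (-1 : ℤˣ) ^ (j * (0 : ZMod 2)) • (g b * f a)
      rw [mul_zero, uzpow_zero, one_smul, this.eq]
    · simp [eq_zero_of_mem_superEnd_zero_right a.2])
  let e : (superEnd n 0) ᵍ⊗[ℝ] 𝒟 ≃ₗ[ℝ] Matrix (Fin n) (Fin n) D :=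
    ((GradedTensorProduct.of ℝ (superEnd n 0) 𝒟).symm.trans (TensorProduct.comm ℝ _ _)).trans
      ((matrixEquivTensor (Fin n ⊕ Fin 0) ℝ D).symm.toLinearEquiv.trans
        (Matrix.reindexLinearEquiv ℝ D (Equiv.sumEmpty (Fin n) (Fin 0))
          (Equiv.sumEmpty (Fin n) (Fin 0))))
  have hFe : F.toLinearMap = e.toLinearMap := by
    refine GradedTensorProduct.hom_ext _ _ (TensorProduct.ext' fun M d => ?_)
    ext a b
    refine (hfg M d a b).trans ?_
    change _ = d * _
    simp [Algebra.smul_def, Algebra.commutes]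
  have hF : Function.Bijective F := by
    have : ⇑F = ⇑e := congrArg DFunLike.coe hFe
    exact this ▸ e.bijective
  refine ⟨AlgEquiv.ofBijective F hF, fun i => le_antisymm ?_ fun M hM => ?_⟩
  · rw [tensorGrading, Submodule.map_span, Submodule.span_le]
    rintro _ ⟨_, ⟨j, k, rfl, a, ha, b, hb, rfl⟩, rfl⟩ p q
    change (f a * g b) p q ∈ _
    fin_cases j
    · rw [hfg]
      have h := Submodule.smul_mem (𝒟 k) (a (.inl p) (.inl q)) hb
      rw [← zero_add k] at h
      exact h
    · rw [eq_zero_of_mem_superEnd_zero_right ha]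
      simp
  · have hsum : M = ∑ p, ∑ q, f (Matrix.single (.inl p) (.inl q) 1) * g (M p q) := by
      ext a b
      simp only [Matrix.sum_apply, hfg, Matrix.single_apply, Sum.inl.injEq, ite_smul, one_smul,
        zero_smul]
      simp [ite_and]
    rw [hsum]
    refine sum_mem fun p _ => sum_mem fun q _ => ?_
    exact ⟨_, Submodule.subset_span
      ⟨0, i, zero_add i, _, mem_superEnd_zero_right _, _, hM p q, rfl⟩, rfl⟩

end MatrixSuperalgebra

theorem IsOddExtension.isDivisionSuperalgebra {K D : Type*} [DivisionRing K] [Algebra ℝ K]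
    [Ring D] [Algebra ℝ D] {ε : ℝ} (hε : ε ≠ 0) {𝒟 : ZMod 2 → Submodule ℝ D}
    (h : IsOddExtension K ε 𝒟) : IsDivisionSuperalgebra 𝒟 := by
  obtain ⟨g, u, hg, h0, h1, hu, huu, hc⟩ := h
  have hg0 : ∀ k, k ≠ 0 → IsUnit (g k) := fun k hk => (IsUnit.mk0 k hk).map g
  have huunit : IsUnit u := by
    have : IsUnit (u * u) := huu ▸ (IsUnit.mk0 ε hε).map (algebraMap ℝ D)
    exact ((Commute.refl u).isUnit_mul_iff.1 this).1
  refine ⟨hg.nontrivial, fun i x hx hx0 => ?_⟩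
  fin_cases i
  · obtain ⟨k, rfl⟩ := (h0 x).1 hx
    exact hg0 k fun hk => hx0 (by rw [hk, map_zero])
  · obtain ⟨k, rfl⟩ := (h1 x).1 hx
    exact (hg0 k fun hk => hx0 (by rw [hk, map_zero, zero_mul])).mul huunit

/-- An odd extension of a matrix algebra over a division algebra `K` is similar to every odd
extension of `K` itself with the same sign. -/
theorem IsOddExtension.superSimilar {K X : Type*} {C : Type} [DivisionRing K] [Algebra ℝ K]
    [Ring X] [Algebra ℝ X] [Ring C] [Algebra ℝ C] {ε : ℝ} (hε : ε ≠ 0) {n : ℕ} (hn : 0 < n)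
    {𝒳 : ZMod 2 → Submodule ℝ X} {𝒞 : ZMod 2 → Submodule ℝ C} [GradedAlgebra 𝒞]
    (hX : IsOddExtension (Matrix (Fin n) (Fin n) K) ε 𝒳) (hC : IsOddExtension K ε 𝒞) :
    SuperSimilar 𝒳 𝒞 := by
  refine ⟨C, inferInstance, inferInstance, 𝒞, inferInstance, hC.isDivisionSuperalgebra hε,
    ⟨n, 0, by omega, ?_⟩, ⟨1, 0, by omega, ?_⟩⟩
  · exact (hX.superIso hε (hC.matrix _)).trans (superIso_tensorGrading_matrixGrading 𝒞 _).symm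
  · have e : Matrix (Fin 1) (Fin 1) K ≃ₐ[ℝ] K :=
      (AlgEquiv.ofBijective (Matrix.scalarAlgHom (Fin 1) ℝ : K →ₐ[ℝ] _)
        ⟨fun a b h => by simpa [Matrix.scalarAlgHom] using congrFun (congrFun h 0) 0,
          fun M => ⟨M 0 0, by ext a b; fin_cases a; fin_cases b; simp [Matrix.scalarAlgHom]⟩⟩).symm
    exact ((hC.congr e).superIso hε (hC.matrix _)).trans
      (superIso_tensorGrading_matrixGrading 𝒞 _).symm

/-! ### Clifford superalgebras that are odd extensions of division algebras -/

section Clifford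

open CliffordAlgebra

theorem evenOdd_isCompl_restrictScalars {F M : Type*} [Field F] [Algebra ℝ F] [AddCommGroup M]
    [Module F M] [Module ℝ M] [IsScalarTower ℝ F M] (Q : QuadraticForm F M) :
    IsCompl ((evenOdd Q 0).restrictScalars ℝ) ((evenOdd Q 1).restrictScalars ℝ) := by
  have hcompl := evenOdd_isCompl Q
  constructor
  · rw [Submodule.disjoint_def]
    have h := Submodule.disjoint_def.1 hcompl.disjoint
    exact h
  · rw [codisjoint_iff, eq_top_iff]
    intro x _
    have h : x ∈ evenOdd Q 0 ⊔ evenOdd Q 1 := hcompl.sup_eq_top.symm ▸ Submodule.mem_top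
    obtain ⟨y, hy, z, hz, rfl⟩ := Submodule.mem_sup.1 h
    exact Submodule.mem_sup.2 ⟨y, hy, z, hz, rfl⟩

/-- A homomorphism `f` from a division algebra to the even part, together with a central odd
element `w` with `w ^ 2 = ε`, exhibits a Clifford superalgebra as an odd extension. The range
of `f` is the even part as soon as it contains the scalars and the products of two vectors. -/
theorem isOddExtension_evenOdd {F M K : Type*} [Field F] [Algebra ℝ F] [AddCommGroup M] [Module F M]
    [Module ℝ M] [IsScalarTower ℝ F M]
    {Q : QuadraticForm F M} [Nontrivial (CliffordAlgebra Q)] [Invertible (2 : F)]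
    [DivisionRing K] [Algebra ℝ K] {ε : ℝ}
    (hε : ε ≠ 0) (f : K →ₐ[ℝ] CliffordAlgebra Q)
    (hf : ∀ k, f k ∈ evenOdd Q 0) {w : CliffordAlgebra Q} (hw : w ∈ evenOdd Q 1)
    (hcomm : ∀ v, Commute w (ι Q v)) (hww : w * w = algebraMap ℝ _ ε)
    (hscal : ∀ c : F, algebraMap F (CliffordAlgebra Q) c ∈ f.range)
    (hι : ∀ v v', ι Q v * ι Q v' ∈ f.range) :
    IsOddExtension K ε fun i => (evenOdd Q i).restrictScalars ℝ := by
  have hc : ∀ x, Commute w x := by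
    intro x
    induction x using CliffordAlgebra.induction with
    | algebraMap r => exact (Algebra.commutes r w).symm
    | ι v => exact hcomm v
    | mul a b ha hb => exact ha.mul_right hb
    | add a b ha hb => exact ha.add_right hb
  have h0 : ∀ x, x ∈ evenOdd Q 0 ↔ ∃ k, f k = x := by
    refine fun x => ⟨fun hx => ?_, fun ⟨k, hk⟩ => hk ▸ hf k⟩
    change x ∈ f.range
    induction x, hx using CliffordAlgebra.even_induction with
    | algebraMap r => exact hscal r
    | add x y _ _ hx hy => exact add_mem hx hy
    | ι_mul_ι_mul v v' x _ hx => exact mul_mem (hι v v') hx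
  refine ⟨f, w, f.toRingHom.injective, h0, fun x => ⟨fun hx => ?_, ?_⟩, hc, hww, ?_⟩
  · have hxw : x * w ∈ evenOdd Q 0 := evenOdd_mul_le Q 1 1 (Submodule.mul_mem_mul hx hw)
    obtain ⟨k, hk⟩ := (h0 _).1 hxw
    refine ⟨ε⁻¹ • k, ?_⟩
    rw [map_smul, hk, smul_mul_assoc, mul_assoc, hww, ← Algebra.commutes, ← Algebra.smul_def,
      smul_smul, inv_mul_cancel₀ hε, one_smul]
  · rintro ⟨k, rfl⟩
    exact evenOdd_mul_le Q 0 1 (Submodule.mul_mem_mul (hf k) hw)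
  · exact evenOdd_isCompl_restrictScalars Q

theorem isOddExtension_realCl {K : Type*} [DivisionRing K] [Algebra ℝ K] {r s : ℕ} {ε : ℝ}
    (hε : ε ≠ 0) (f : K →ₐ[ℝ] CliffordAlgebra (realForm r s))
    (hf : ∀ k, f k ∈ realCl r s 0) {w : CliffordAlgebra (realForm r s)} (hw : w ∈ realCl r s 1)
    (hcomm : ∀ a, Commute w (ι (realForm r s) (Pi.single a 1))) (hww : w * w = algebraMap ℝ _ ε)
    (hι : ∀ a b, ι (realForm r s) (Pi.single a 1) * ι (realForm r s) (Pi.single b 1) ∈ f.range) :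
    IsOddExtension K ε (realCl r s) := by
  have hv : ∀ v, ι (realForm r s) v = ∑ a, v a • ι (realForm r s) (Pi.single a 1) := fun v => by
    conv_lhs => rw [pi_eq_sum_univ' v]
    simp only [map_sum, map_smul]
  refine isOddExtension_evenOdd hε f hf hw (fun v => ?_) hww (fun c => f.range.algebraMap_mem c)
    fun v v' => ?_
  · rw [hv v]
    exact Commute.sum_right _ _ _ fun a _ => (hcomm a).smul_right _
  · rw [hv v, hv v']
    simp only [Finset.sum_mul_sum, smul_mul_smul_comm]
    exact sum_mem fun a _ => sum_mem fun b _ => Subalgebra.smul_mem _ (hι a b) _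

theorem ι_single_mul_self (r s : ℕ) (a : Fin r ⊕ Fin s) :
    ι (realForm r s) (Pi.single a 1) * ι (realForm r s) (Pi.single a 1) =
      Sum.elim (fun _ => (1 : ℝ)) (fun _ => (-1 : ℝ)) a • 1 := by
  rw [ι_sq_scalar, Algebra.algebraMap_eq_smul_one]
  congr 1
  simp [realForm, QuadraticMap.weightedSumSquares_apply, Pi.single_apply]

theorem ι_single_mul_ι_single (r s : ℕ) {a b : Fin r ⊕ Fin s} (h : a ≠ b) :
    ι (realForm r s) (Pi.single a 1) * ι (realForm r s) (Pi.single b 1) =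
      -(ι (realForm r s) (Pi.single b 1) * ι (realForm r s) (Pi.single a 1)) := by
  apply ι_mul_ι_comm_of_isOrtho
  rw [QuadraticMap.isOrtho_def]
  simp only [realForm, QuadraticMap.weightedSumSquares_apply, ← Finset.sum_add_distrib, ← smul_add]
  refine Finset.sum_congr rfl fun c _ => ?_
  congr 1
  by_cases hc : c = a
  · subst hc; simp [h]
  · simp [hc]

/-- Three anticommuting elements of the same square `δ = ±1` generate the quaternions: `x y` and
`y z` anticommute and have square `-1`. The product `x y z` commutes with all of them and has
square `-δ`. -/
theorem quaternion_relations {E : Type*} [Ring E] [Algebra ℝ E] {x y z : E} {δ : ℝ}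
    (hδ : δ * δ = 1) (hx : x * x = δ • 1) (hy : y * y = δ • 1) (hz : z * z = δ • 1)
    (hyx : y * x = -(x * y)) (hzx : z * x = -(x * z)) (hzy : z * y = -(y * z)) :
    (x * y) * (x * y) = -1 ∧ (y * z) * (y * z) = algebraMap ℝ E (-1) ∧
      (y * z) * (x * y) = -((x * y) * (y * z)) ∧
      (x * y * z) * (x * y * z) = algebraMap ℝ E (-δ) ∧
      Commute (x * y * z) x ∧ Commute (x * y * z) y ∧ Commute (x * y * z) z ∧
      x * z = δ • ((x * y) * (y * z)) := by
  have hx' : ∀ t, x * (x * t) = δ • t := fun t => by rw [← mul_assoc, hx, smul_mul_assoc, one_mul]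
  have hy' : ∀ t, y * (y * t) = δ • t := fun t => by rw [← mul_assoc, hy, smul_mul_assoc, one_mul]
  have hyx' : ∀ t, y * (x * t) = -(x * (y * t)) := fun t => by rw [← mul_assoc, hyx]; noncomm_ring
  have hzx' : ∀ t, z * (x * t) = -(x * (z * t)) := fun t => by rw [← mul_assoc, hzx]; noncomm_ring
  have hzy' : ∀ t, z * (y * t) = -(y * (z * t)) := fun t => by rw [← mul_assoc, hzy]; noncomm_ring
  simp only [commute_iff_eq, mul_assoc, hyx', hzx', hzy', hx', hy', hzx, hzy, hx, hy, hz,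
    mul_neg, mul_smul_comm, smul_smul, hδ, one_smul, mul_one, smul_neg, neg_neg,
    Algebra.algebraMap_eq_smul_one, neg_smul, and_self]

theorem isOddExtension_quaternion_of_three {r s : ℕ} {δ : ℝ} (hδ : δ * δ = 1)
    (e : Fin 3 ≃ Fin r ⊕ Fin s)
    (he : ∀ a, Sum.elim (fun _ => (1 : ℝ)) (fun _ => (-1 : ℝ)) (e a) = δ) :
    IsOddExtension ℍ[ℝ] (-δ) (realCl r s) := by
  let g : Fin 3 → CliffordAlgebra (realForm r s) := fun a => ι (realForm r s) (Pi.single (e a) 1)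
  have hsq : ∀ a, g a * g a = δ • 1 := fun a => by rw [ι_single_mul_self, he]
  have hanti : ∀ a b, a ≠ b → g a * g b = -(g b * g a) := fun a b h =>
    ι_single_mul_ι_single r s (e.injective.ne h)
  obtain ⟨hi, hj, hji, hww, hc0, hc1, hc2, h02⟩ := quaternion_relations hδ (hsq 0) (hsq 1) (hsq 2)
    (hanti 1 0 (by decide)) (hanti 2 0 (by decide)) (hanti 2 1 (by decide))
  let q := quaternionBasisOf hi hj hji
  let f : ℍ[ℝ] →ₐ[ℝ] CliffordAlgebra (realForm r s) := q.liftHom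
  have hmemi : g 0 * g 1 ∈ f.range := ⟨⟨0, 1, 0, 0⟩, by
    change q.lift _ = _
    simp [QuaternionAlgebra.Basis.lift, q, quaternionBasisOf]⟩
  have hmemj : g 1 * g 2 ∈ f.range := ⟨⟨0, 0, 1, 0⟩, by
    change q.lift _ = _
    simp [QuaternionAlgebra.Basis.lift, q, quaternionBasisOf]⟩
  have hmemk : g 0 * g 2 ∈ f.range := h02 ▸ Subalgebra.smul_mem _ (mul_mem hmemi hmemj) _
  have hmem : ∀ a b, g a * g b ∈ f.range := by
    intro a b
    rcases eq_or_ne a b with rfl | hab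
    · rw [hsq]
      exact Subalgebra.smul_mem _ (one_mem _) _
    · fin_cases a <;> fin_cases b <;> first
        | exact absurd rfl hab | exact hmemi | exact hmemj | exact hmemk
        | (rw [hanti _ _ hab]; exact neg_mem ‹_›)
  have heven : ∀ a b, g a * g b ∈ even (realForm r s) := fun a b =>
    ι_mul_ι_mem_evenOdd_zero _ _ _
  have hδ0 : δ ≠ 0 := fun h => by simp [h] at hδ
  refine isOddExtension_realCl (neg_ne_zero.2 hδ0) f (fun k => ?_) (w := g 0 * g 1 * g 2) ?_
    (fun a => ?_) hww (fun a b => ?_)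
  · change q.lift k ∈ even (realForm r s)
    exact add_mem (add_mem (add_mem (Subalgebra.algebraMap_mem _ _)
      (Subalgebra.smul_mem _ (heven _ _) _)) (Subalgebra.smul_mem _ (heven _ _) _))
      (Subalgebra.smul_mem _ (mul_mem (heven _ _) (heven _ _)) _)
  · exact evenOdd_mul_le _ 0 1 (Submodule.mul_mem_mul (heven _ _) (ι_mem_evenOdd_one _ _))
  · obtain ⟨a, rfl⟩ := e.surjective a
    fin_cases a
    exacts [hc0, hc1, hc2]
  · obtain ⟨a, rfl⟩ := e.surjective a
    obtain ⟨b, rfl⟩ := e.surjective b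
    exact hmem a b

theorem isOddExtension_real_of_unique {r s : ℕ} {δ : ℝ} (hδ : δ ≠ 0) (a : Fin r ⊕ Fin s)
    (ha : ∀ b, b = a) (he : Sum.elim (fun _ => (1 : ℝ)) (fun _ => (-1 : ℝ)) a = δ) :
    IsOddExtension ℝ δ (realCl r s) := by
  have hsq := ι_single_mul_self r s a
  rw [he] at hsq
  refine isOddExtension_realCl hδ (Algebra.ofId ℝ _) (fun k => ?_)
    (w := ι (realForm r s) (Pi.single a 1)) (ι_mem_evenOdd_one _ _) (fun b => ?_) ?_ fun b c => ?_
  · exact SetLike.algebraMap_mem_graded (evenOdd (realForm r s)) k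
  · rw [ha b]
  · rw [hsq, Algebra.algebraMap_eq_smul_one]
  · rw [ha b, ha c, hsq]
    exact Subalgebra.smul_mem _ (one_mem _) _

theorem isOddExtension_realCl_one_zero : IsOddExtension ℝ 1 (realCl 1 0) :=
  isOddExtension_real_of_unique one_ne_zero (.inl 0)
    (by rintro (b | b); exacts [by rw [Subsingleton.elim b 0], b.elim0]) rfl

theorem isOddExtension_realCl_zero_one : IsOddExtension ℝ (-1) (realCl 0 1) :=
  isOddExtension_real_of_unique (by norm_num) (.inr 0)
    (by rintro (b | b); exacts [b.elim0, by rw [Subsingleton.elim b 0]]) rfl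

theorem isOddExtension_realCl_three_zero : IsOddExtension ℍ[ℝ] (-1) (realCl 3 0) :=
  isOddExtension_quaternion_of_three (by norm_num) (Equiv.sumEmpty _ _).symm fun _ => rfl

theorem isOddExtension_realCl_zero_three : IsOddExtension ℍ[ℝ] 1 (realCl 0 3) := by
  simpa using isOddExtension_quaternion_of_three (δ := -1) (by norm_num)
    (Equiv.emptySum _ _).symm (fun _ => rfl)

theorem isOddExtension_complexCl_one : IsOddExtension ℂ 1 (complexCl 1) := by
  have hv : ∀ v, ι (complexForm 1) v = v 0 • ι (complexForm 1) (Pi.single 0 1) := fun v => by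
    rw [← map_smul]
    congr 1
    ext c
    simp [Subsingleton.elim c 0]
  have hsq : ι (complexForm 1) (Pi.single 0 1) * ι (complexForm 1) (Pi.single 0 1) = 1 := by
    have h : complexForm 1 (Pi.single 0 1) = 1 := by
      simp [complexForm, QuadraticMap.weightedSumSquares_apply]
    rw [ι_sq_scalar, h, map_one]
  refine isOddExtension_evenOdd one_ne_zero ((Algebra.ofId ℂ _).restrictScalars ℝ) (fun k => ?_)
    (w := ι (complexForm 1) (Pi.single 0 1)) (ι_mem_evenOdd_one _ _) (fun v => ?_) ?_
    (fun c => ⟨c, rfl⟩) fun v v' => ?_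
  · exact SetLike.algebraMap_mem_graded (evenOdd (complexForm 1)) k
  · rw [hv v]
    exact (Commute.refl _).smul_right _
  · rw [hsq, map_one]
  · rw [hv v, hv v', smul_mul_smul_comm, hsq]
    exact ⟨v 0 * v' 0, by simp [Algebra.algebraMap_eq_smul_one]⟩

/-- The parity grading of `ℂl_n` remains a grading over `ℝ`. -/
noncomputable instance complexCl.gradedAlgebra (n : ℕ) : GradedAlgebra (complexCl n) where
  one_mem := SetLike.GradedOne.one_mem (A := evenOdd (complexForm n))
  mul_mem _ _ _ _ hx hy := evenOdd_mul_le _ _ _ (Submodule.mul_mem_mul hx hy)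
  __ := DirectSum.IsInternal.chooseDecomposition (complexCl n) <| by
    rw [DirectSum.isInternal_submodule_iff_isCompl (complexCl n) (i := 0) (j := 1) zero_ne_one
      (by ext i; revert i; decide)]
    exact evenOdd_isCompl_restrictScalars (complexForm n)

noncomputable instance realCl.gradedAlgebra (r s : ℕ) : GradedAlgebra (realCl r s) :=
  inferInstanceAs (GradedAlgebra (evenOdd (realForm r s)))

end Clifford

/-! ### Telling the Dyson types apart -/

theorem not_nonempty_algEquiv_prod {R X Y : Type*} [Ring R] [Algebra ℝ R] [IsSimpleRing R] [Ring X]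
    [Algebra ℝ X] [Nontrivial X] [Ring Y] [Algebra ℝ Y] [Nontrivial Y] :
    ¬ Nonempty (R ≃ₐ[ℝ] X × Y) := by
  rintro ⟨e⟩
  let f : R →ₐ[ℝ] X := (AlgHom.fst ℝ X Y).comp e.toAlgHom
  have hf : f (e.symm (0, 1)) = f 0 := by simp [f]
  have h : e.symm (0, 1) = 0 := f.toRingHom.injective hf
  rw [map_eq_zero_iff _ e.symm.injective, Prod.mk_eq_zero] at h
  exact one_ne_zero h.2

instance Quaternion.isCentral : Algebra.IsCentral ℝ ℍ[ℝ] where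
  out := by
    intro x hx
    let i : ℍ[ℝ] := ⟨0, 1, 0, 0⟩
    let j : ℍ[ℝ] := ⟨0, 0, 1, 0⟩
    have hi : x * i = i * x := (Subalgebra.mem_center_iff.1 hx i).symm
    have hj : x * j = j * x := (Subalgebra.mem_center_iff.1 hx j).symm
    have h1 := congrArg QuaternionAlgebra.imJ hi
    have h2 := congrArg QuaternionAlgebra.imK hi
    have h3 := congrArg QuaternionAlgebra.imK hj
    rw [Quaternion.imJ_mul, Quaternion.imJ_mul] at h1
    rw [Quaternion.imK_mul, Quaternion.imK_mul] at h2 h3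
    simp only [i, j, mul_zero, mul_one, zero_mul, one_mul, add_zero, zero_add, sub_zero,
      zero_sub] at h1 h2 h3
    refine Algebra.mem_bot.2 ⟨x.re, ?_⟩
    ext
    · rfl
    · change 0 = x.imI; linarith
    · change 0 = x.imJ; linarith
    · change 0 = x.imK; linarith

theorem not_isCentral_matrix_complex {n : ℕ} (hn : 0 < n) : ¬ Algebra.IsCentral ℝ (Mat ℂ n) := by
  intro h
  have hmem : algebraMap ℂ (Mat ℂ n) Complex.I ∈ Subalgebra.center ℝ (Mat ℂ n) :=
    Subalgebra.mem_center_iff.2 fun b => (Algebra.commutes _ b).symm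
  obtain ⟨a, ha⟩ := Algebra.mem_bot.1 (h.out hmem)
  rw [IsScalarTower.algebraMap_apply ℝ ℂ (Mat ℂ n)] at ha
  have : Nonempty (Fin n) := ⟨⟨0, hn⟩⟩
  have := congrArg Complex.im ((algebraMap ℂ (Mat ℂ n)).injective ha)
  simp at this

/-- `ℝ(a)` contains `a` orthogonal idempotents whereas `ℍ(b)`, acting on row vectors, has at most
`b` of them; but equality of dimensions forces `a = 2 b`. -/
theorem not_nonempty_algEquiv_real_quaternion {a b : ℕ} (hb : 0 < b) :
    ¬ Nonempty (Mat ℝ a ≃ₐ[ℝ] Mat ℍ[ℝ] b) := by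
  rintro ⟨f⟩
  have hdim : a * a = b * b * 4 := by
    have := f.toLinearEquiv.finrank_eq
    simpa [Module.finrank_matrix, Quaternion.finrank_eq_four] using this
  let e : Fin a → Mat ℍ[ℝ] b := fun p => f (Matrix.single p p 1)
  have he : ∀ p q, e p * e q = if p = q then e p else 0 := by
    intro p q
    rw [← map_mul]
    split_ifs with h
    · subst h; simp [e]
    · rw [Matrix.single_mul_single_of_ne _ _ _ _ h, map_zero]
  have hne : ∀ p, ∃ v, Matrix.vecMul v (e p) ≠ 0 := by
    intro p
    by_contra! h
    have h0 : e p = 0 := by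
      ext1 i j
      have := congrFun (h (Pi.single i 1)) j
      simpa using this
    rw [map_eq_zero_iff _ f.injective] at h0
    simpa using congrFun (congrFun h0 p) p
  choose v hv using hne
  have hw : ∀ p q, Matrix.vecMul (Matrix.vecMul (v p) (e p)) (e q) =
      if p = q then Matrix.vecMul (v p) (e p) else 0 := by
    intro p q
    rw [Matrix.vecMul_vecMul, he]
    split_ifs <;> simp
  have hli : LinearIndependent ℍ[ℝ] fun p => Matrix.vecMul (v p) (e p) := by
    rw [Fintype.linearIndependent_iff]
    intro c hc q
    have h := congrArg (fun x => Matrix.vecMul x (e q)) hc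
    simp only [Matrix.sum_vecMul, Matrix.smul_vecMul, hw, Matrix.zero_vecMul] at h
    simpa [hv q] using h
  have hle := hli.fintype_card_le_finrank
  simp only [Fintype.card_fin, Module.finrank_fin_fun] at hle
  nlinarith

/-! ### Algebras with a faithful simple module -/

/-- A finite-dimensional algebra with a faithful simple module `W` is simple: it embeds into a power
of `W`, hence is semisimple with all simple left ideals isomorphic to `W`. -/
theorem isSimpleRing_of_faithful_isSimpleModule {A W : Type*} [Ring A] [Algebra ℝ A]
    [Module.Finite ℝ A] [AddCommGroup W] [Module ℝ W] [Module.Finite ℝ W] [Module A W]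
    [IsScalarTower ℝ A W]
    [IsSimpleModule A W] (hfaithful : ∀ a : A, (∀ w : W, a • w = 0) → a = 0) : IsSimpleRing A := by
  have hW := IsSimpleModule.nontrivial A W
  have hnt : Nontrivial A := by
    obtain ⟨w, hw⟩ := exists_ne (0 : W)
    exact ⟨0, 1, fun h => hw (by rw [← one_smul A w, ← h, zero_smul])⟩
  let b := Module.finBasis ℝ W
  let F : A →ₗ[A] (Fin (Module.finrank ℝ W) → W) := LinearMap.pi fun k =>
    LinearMap.toSpanSingleton A W (b k)
  have hF : Function.Injective F := by
    rw [injective_iff_map_eq_zero]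
    refine fun a ha => hfaithful a fun w => ?_
    have hab : ∀ k, a • b k = 0 := fun k => congrFun ha k
    have hcomm : ∀ (r : ℝ) (w : W), a • r • w = r • a • w := fun r w => by
      rw [← algebraMap_smul A r w, ← algebraMap_smul A r (a • w), smul_smul, smul_smul,
        Algebra.commutes]
    rw [← b.sum_repr w, Finset.smul_sum]
    exact Finset.sum_eq_zero fun k _ => by rw [hcomm, hab, smul_zero]
  have hss : IsSemisimpleRing A := IsSemisimpleModule.of_injective F hF
  have hiso : IsIsotypicOfType A A W := by
    intro m _
    have hm := IsSimpleModule.nontrivial A m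
    obtain ⟨x, hx⟩ := exists_ne (0 : m)
    obtain ⟨w, hw⟩ : ∃ w : W, (x : A) • w ≠ 0 := by
      by_contra! h
      exact hx (Subtype.ext (hfaithful _ h))
    let f : m →ₗ[A] W := (LinearMap.toSpanSingleton A W w).comp m.subtype
    have hf : f ≠ 0 := fun h => hw (LinearMap.congr_fun h x)
    exact ⟨LinearEquiv.ofBijective f (LinearMap.bijective_of_ne_zero hf)⟩
  exact (isSimpleRing_isArtinianRing_iff.2 ⟨hss, hiso.isIsotypic, hnt⟩).1

/-- A finite-dimensional simple real algebra is a matrix algebra over `ℝ`, `ℂ` or `ℍ`. -/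
theorem exists_algEquiv_matrix_of_isSimpleRing (A : Type*) [Ring A] [Algebra ℝ A]
    [Module.Finite ℝ A] [IsSimpleRing A] : ∃ n : ℕ, 0 < n ∧ (Nonempty (A ≃ₐ[ℝ] Mat ℝ n) ∨
      Nonempty (A ≃ₐ[ℝ] Mat ℂ n) ∨ Nonempty (A ≃ₐ[ℝ] Mat ℍ[ℝ] n)) := by
  have : IsArtinianRing A := isArtinian_of_tower ℝ inferInstance
  obtain ⟨n, hn, K, _, _, _, ⟨e⟩⟩ :=
    IsSimpleRing.exists_algEquiv_matrix_divisionRing_finite ℝ A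
  refine ⟨n, Nat.pos_of_ne_zero hn.out, ?_⟩
  rcases nonempty_algEquiv_real_or_complex_or_quaternion K with ⟨⟨f⟩⟩ | ⟨⟨f⟩⟩ | ⟨⟨f⟩⟩
  exacts [.inl ⟨e.trans f.mapMatrix⟩, .inr (.inl ⟨e.trans f.mapMatrix⟩),
    .inr (.inr ⟨e.trans f.mapMatrix⟩)]

/-! ### The algebras of a `φ`-representation with a time reversal -/

namespace PhiRep

variable {G : Type*} [Group G] [TopologicalSpace G] {φ : G →* ℤˣ}
  {V : Type*} [NormedAddCommGroup V] [NormedSpace ℝ V] (R : PhiRep φ V) {T : G}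

theorem ρ_mem_algA {g : G} (hg : φ g = 1) : R.ρ g ∈ R.algA :=
  Algebra.subset_adjoin ⟨g, hg, rfl⟩

theorem commute_of_mem_algA {x : Module.End ℝ V} (hx : ∀ g, φ g = 1 → Commute (R.ρ g) x)
    {a : Module.End ℝ V} (ha : a ∈ R.algA) : Commute a x := by
  refine Algebra.adjoin_induction (fun y hy => ?_) (fun r => Algebra.commutes r x)
    (fun y z _ _ hy hz => hy.add_left hz) (fun y z _ _ hy hz => hy.mul_left hz) ha
  obtain ⟨g, hg, rfl⟩ := hy
  exact hx g hg

theorem commute_I {a : Module.End ℝ V} (ha : a ∈ R.algA) : Commute a R.I :=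
  R.commute_of_mem_algA (fun g hg => by simpa [commute_iff_eq, hg] using R.ρ_mul_I g) ha

theorem commute_ρ (hT : IsTimeReversal φ T) {a : Module.End ℝ V} (ha : a ∈ R.algA) :
    Commute a (R.ρ T) :=
  R.commute_of_mem_algA (fun g hg => by
    rw [commute_iff_eq, ← map_mul, ← map_mul, hT.2 g hg]) ha

theorem ρ_mul_I_eq_neg {g : G} (hg : φ g = -1) : R.ρ g * R.I = -(R.I * R.ρ g) := by
  simpa [hg] using R.ρ_mul_I g

theorem ρ_mul_self_mem_algA (hT : IsTimeReversal φ T) : R.ρ T * R.ρ T ∈ R.algA := by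
  rw [← map_mul]
  exact R.ρ_mem_algA (by rw [map_mul, hT.1]; rfl)

/-- Every odd operator is an even operator times `ρ T`. -/
theorem exists_ρ_eq_mul (hT : IsTimeReversal φ T) {g : G} (hg : φ g = -1) :
    ∃ h, φ h = 1 ∧ R.ρ g = R.ρ h * R.ρ T := by
  refine ⟨g * T⁻¹, by rw [map_mul, map_inv, hg, hT.1]; rfl, ?_⟩
  rw [← map_mul, inv_mul_cancel_right]

theorem eq_bot_or_eq_top_of_invariant (hT : IsTimeReversal φ T) (hR : R.IsIrreducible)
    (W : Submodule ℝ V) (hI : ∀ w ∈ W, R.I w ∈ W) (hA : ∀ a ∈ R.algA, ∀ w ∈ W, a w ∈ W)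
    (hτ : ∀ w ∈ W, R.ρ T w ∈ W) : W = ⊥ ∨ W = ⊤ := by
  refine hR.2 W hI fun g w hw => ?_
  by_cases hg : φ g = 1
  · exact hA _ (R.ρ_mem_algA hg) w hw
  · obtain ⟨h, hh, hgh⟩ := R.exists_ρ_eq_mul hT ((Int.units_eq_one_or (φ g)).resolve_left hg)
    rw [hgh]
    exact hA _ (R.ρ_mem_algA hh) _ (hτ w hw)

/-- The vectors annihilated by all `a b`, `b ∈ 𝒜`, form a `φ`-subrepresentation because `I` and
`ρ T` commute with `𝒜`. So an element of `𝒜` annihilating a simple `𝒜`-submodule is zero. -/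
theorem isSimpleRing_algA [FiniteDimensional ℝ V] (hT : IsTimeReversal φ T)
    (hR : R.IsIrreducible) : IsSimpleRing R.algA := by
  have := hR.1
  have : IsArtinian R.algA V := isArtinian_of_tower ℝ inferInstance
  obtain ⟨W, hW⟩ := IsAtomic.exists_atom (Submodule R.algA V)
  have hWs : IsSimpleModule R.algA W := isSimpleModule_iff_isAtom.2 hW
  have hfin : Module.Finite ℝ W := inferInstanceAs (Module.Finite ℝ (W.restrictScalars ℝ))
  refine isSimpleRing_of_faithful_isSimpleModule (W := W) fun a ha => ?_
  let U : Submodule ℝ V := ⨅ b : R.algA, LinearMap.ker (a.1 * b.1)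
  have hU : ∀ v, v ∈ U ↔ ∀ b : R.algA, a.1 (b.1 v) = 0 := fun v => by simp [U]
  have hcomm : ∀ x : Module.End ℝ V, (∀ c ∈ R.algA, Commute c x) → ∀ v ∈ U, x v ∈ U := by
    intro x hx v hv
    rw [hU] at hv ⊢
    intro b
    have h := LinearMap.congr_fun (hx _ (mul_mem a.2 b.2)).eq v
    simp only [Module.End.mul_apply, hv b, map_zero] at h
    exact h
  have hWU : ∀ w ∈ W, w ∈ U := fun w hw => (hU w).2 fun b =>
    congrArg Subtype.val (ha ⟨b • w, W.smul_mem b hw⟩)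
  rcases R.eq_bot_or_eq_top_of_invariant hT hR U (hcomm _ fun c hc => R.commute_I hc)
    (fun c hc v hv => (hU _).2 fun b => (hU v).1 hv (b * ⟨c, hc⟩))
    (hcomm _ fun c hc => R.commute_ρ hT hc) with h | h
  · refine absurd ((Submodule.eq_bot_iff W).2 fun w hw => ?_) hW.1
    simpa [h] using hWU w hw
  · ext v
    have hv : v ∈ U := h ▸ Submodule.mem_top
    exact (hU v).1 hv 1

end PhiRep

namespace PhiRep

variable {G : Type*} [Group G] [TopologicalSpace G] {φ : G →* ℤˣ}
  {V : Type*} [NormedAddCommGroup V] [NormedSpace ℝ V] (R : PhiRep φ V) {T : G}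

theorem algA_le_algB : R.algA ≤ R.algB := Algebra.adjoin_mono (Set.subset_insert _ _)

theorem algA_le_algAs : R.algA ≤ R.algAs :=
  Algebra.adjoin_mono (by rintro _ ⟨g, -, rfl⟩; exact ⟨g, rfl⟩)

theorem algAs_le_algD : R.algAs ≤ R.algD := Algebra.adjoin_mono (Set.subset_insert _ _)

theorem ρ_mem_algAs (g : G) : R.ρ g ∈ R.algAs := Algebra.subset_adjoin ⟨g, rfl⟩

theorem I_mem_algB : R.I ∈ R.algB := Algebra.subset_adjoin (Set.mem_insert _ _)

theorem I_mem_algD : R.I ∈ R.algD := Algebra.subset_adjoin (Set.mem_insert _ _)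

/-- An odd operator `σ` obtained from the time reversal `ρ T` by a central rescaling within `𝒜`,
normalized to `σ ^ 2 = ε`. -/
structure IsNormalizedTimeReversal (T : G) (σ : Module.End ℝ V) (ε : ℝ) : Prop where
  commute : ∀ a ∈ R.algA, Commute a σ
  mul_self : σ * σ = algebraMap ℝ _ ε
  ne_zero : ε ≠ 0
  exists_eq_mul : ∃ d ∈ R.algA, σ = d * R.ρ T
  exists_mul_eq : ∃ d ∈ R.algA, d * σ = R.ρ T

namespace IsNormalizedTimeReversal

variable {R} {σ : Module.End ℝ V} {ε : ℝ}

theorem mul_I (h : R.IsNormalizedTimeReversal T σ ε) (hT : IsTimeReversal φ T) :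
    σ * R.I = -(R.I * σ) := by
  obtain ⟨d, hd, rfl⟩ := h.exists_eq_mul
  rw [mul_assoc, R.ρ_mul_I_eq_neg hT.1, mul_neg, ← mul_assoc, (R.commute_I hd).eq, mul_assoc]

theorem mem_algAs (h : R.IsNormalizedTimeReversal T σ ε) : σ ∈ R.algAs := by
  obtain ⟨d, hd, rfl⟩ := h.exists_eq_mul
  exact mul_mem (R.algA_le_algAs hd) (R.ρ_mem_algAs T)

theorem nonempty_algD_algEquiv (h : R.IsNormalizedTimeReversal T σ ε) (hT : IsTimeReversal φ T) :
    Nonempty (R.algD ≃ₐ[ℝ] ℍ[ℝ,-1,0,ε] ⊗[ℝ] R.algA) := by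
  have hinj := quaternionTensorLift_injective h.ne_zero R.I_mul_I h.mul_self (h.mul_I hT)
    R.algA.val Subtype.val_injective (fun a => R.commute_I a.2) (fun a => h.commute a a.2)
  refine AlgHom.nonempty_algEquiv_of_range_eq _ hinj ?_
  rw [Algebra.TensorProduct.range_lift_eq, QuaternionAlgebra.Basis.range_liftHom,
    Subalgebra.range_val]
  have hσ : σ ∈ R.algD := R.algAs_le_algD h.mem_algAs
  apply le_antisymm
  · refine sup_le (Algebra.adjoin_le ?_) (R.algA_le_algAs.trans R.algAs_le_algD)
    rintro x (rfl | rfl | rfl)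
    exacts [R.I_mem_algD, hσ, mul_mem R.I_mem_algD hσ]
  · refine Algebra.adjoin_le ?_
    rintro x (rfl | ⟨g, rfl⟩)
    · exact (le_sup_left : _ ≤ _ ⊔ R.algA) (Algebra.subset_adjoin (.inl rfl))
    have hA : ∀ a ∈ R.algA, a ∈ Algebra.adjoin ℝ {R.I, σ, R.I * σ} ⊔ R.algA := fun a ha =>
      (le_sup_right : R.algA ≤ _) ha
    have hσ' : σ ∈ Algebra.adjoin ℝ {R.I, σ, R.I * σ} ⊔ R.algA :=
      (le_sup_left : _ ≤ _ ⊔ R.algA) (Algebra.subset_adjoin (.inr (.inl rfl)))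
    by_cases hg : φ g = 1
    · exact hA _ (R.ρ_mem_algA hg)
    · obtain ⟨k, hk, hgk⟩ := R.exists_ρ_eq_mul hT ((Int.units_eq_one_or (φ g)).resolve_left hg)
      obtain ⟨d, hd, hdσ⟩ := h.exists_mul_eq
      rw [hgk, ← hdσ]
      exact mul_mem (hA _ (R.ρ_mem_algA hk)) (mul_mem (hA _ hd) hσ')

theorem nonempty_algB_algEquiv (h : R.IsNormalizedTimeReversal T σ ε) (hT : IsTimeReversal φ T) :
    Nonempty (R.algB ≃ₐ[ℝ] ℂ ⊗[ℝ] R.algA) := by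
  have hinj := complexTensorLift_injective h.ne_zero R.I_mul_I h.mul_self (h.mul_I hT)
    R.algA.val Subtype.val_injective (fun a => R.commute_I a.2) (fun a => h.commute a a.2)
  refine AlgHom.nonempty_algEquiv_of_range_eq _ hinj ?_
  rw [Algebra.TensorProduct.range_lift_eq, Subalgebra.range_val]
  apply le_antisymm
  · refine sup_le ?_ R.algA_le_algB
    rintro _ ⟨z, rfl⟩
    exact add_mem (R.algB.algebraMap_mem _) (R.algB.smul_mem R.I_mem_algB _)
  · refine Algebra.adjoin_le ?_
    rintro x (rfl | ⟨g, hg, rfl⟩)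
    · exact (le_sup_left : _ ≤ _ ⊔ R.algA) ⟨Complex.I, by simp⟩
    · exact (le_sup_right : R.algA ≤ _) (R.ρ_mem_algA hg)

end IsNormalizedTimeReversal

theorem span_even_eq_algA :
    Submodule.span ℝ {x | ∃ g, φ g = 1 ∧ x = R.ρ g} = Subalgebra.toSubmodule R.algA := by
  have hset : {x | ∃ g, φ g = 1 ∧ x = R.ρ g} = (φ.ker.toSubmonoid.map R.ρ : Set _) := by
    ext x
    simp [eq_comm]
  rw [algA, Algebra.adjoin_eq_span, hset, Submonoid.closure_eq]

theorem span_range_ρ_eq_algAs :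
    Submodule.span ℝ (Set.range R.ρ) = Subalgebra.toSubmodule R.algAs := by
  rw [algAs, Algebra.adjoin_eq_span, ← MonoidHom.coe_mrange, Submonoid.closure_eq]

theorem mem_gradingAs_zero {x : R.algAs} : x ∈ R.gradingAs 0 ↔ x.1 ∈ R.algA := by
  change x.1 ∈ Submodule.span ℝ
    {x | ∃ g, φ g = (if (0 : ZMod 2) = 0 then 1 else -1) ∧ x = R.ρ g} ↔ _
  rw [if_pos rfl, span_even_eq_algA]
  rfl

theorem IsNormalizedTimeReversal.mem_gradingAs_one {R : PhiRep φ V} {σ : Module.End ℝ V} {ε : ℝ}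
    (h : R.IsNormalizedTimeReversal T σ ε) (hT : IsTimeReversal φ T) {x : R.algAs} :
    x ∈ R.gradingAs 1 ↔ ∃ a ∈ R.algA, a * σ = x.1 := by
  change x.1 ∈ Submodule.span ℝ
    {x | ∃ g, φ g = (if (1 : ZMod 2) = 0 then 1 else -1) ∧ x = R.ρ g} ↔ _
  rw [if_neg one_ne_zero]
  obtain ⟨d, hd, hdσ⟩ := h.exists_mul_eq
  obtain ⟨d', hd', hd'σ⟩ := h.exists_eq_mul
  constructor
  · intro hx
    suffices hle : Submodule.span ℝ {x | ∃ g, φ g = -1 ∧ x = R.ρ g} ≤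
        (Subalgebra.toSubmodule R.algA).map (LinearMap.mulRight ℝ σ) from hle hx
    rw [Submodule.span_le]
    rintro _ ⟨g, hg, rfl⟩
    obtain ⟨k, hk, hgk⟩ := R.exists_ρ_eq_mul hT hg
    exact ⟨R.ρ k * d, R.algA.mul_mem (R.ρ_mem_algA hk) hd, by simp [hgk, ← hdσ, mul_assoc]⟩
  · rintro ⟨a, ha, hax⟩
    have hle : (Subalgebra.toSubmodule R.algA).map (LinearMap.mulRight ℝ (R.ρ T)) ≤
        Submodule.span ℝ {x | ∃ g, φ g = -1 ∧ x = R.ρ g} := by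
      rw [← span_even_eq_algA, Submodule.map_span, Submodule.span_le]
      rintro _ ⟨_, ⟨g, hg, rfl⟩, rfl⟩
      exact Submodule.subset_span ⟨g * T, by rw [map_mul, hg, hT.1, one_mul], by simp⟩
    rw [← hax, hd'σ, ← mul_assoc]
    exact hle ⟨a * d', R.algA.mul_mem ha hd', rfl⟩

/-- The group superalgebra is obtained from its even part `𝒜` by adjoining the central odd
element `σ`. -/
theorem IsNormalizedTimeReversal.isOddExtension {R : PhiRep φ V} {σ : Module.End ℝ V} {ε : ℝ}
    (h : R.IsNormalizedTimeReversal T σ ε) (hT : IsTimeReversal φ T) :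
    IsOddExtension R.algA ε R.gradingAs := by
  have hdecomp : ∀ x : R.algAs, ∃ y ∈ R.gradingAs 0, ∃ z ∈ R.gradingAs 1, y + z = x := by
    rintro ⟨x, hx⟩
    have hx' : x ∈ Submodule.span ℝ (Set.range R.ρ) := R.span_range_ρ_eq_algAs ▸ hx
    induction hx' using Submodule.span_induction with
    | mem x hxρ =>
      obtain ⟨g, rfl⟩ := hxρ
      by_cases hg : φ g = 1
      · exact ⟨⟨R.ρ g, hx⟩, R.mem_gradingAs_zero.2 (R.ρ_mem_algA hg), 0, zero_mem _, add_zero _⟩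
      · refine ⟨0, zero_mem _, ⟨R.ρ g, hx⟩, Submodule.subset_span ⟨g, ?_, rfl⟩, zero_add _⟩
        exact (Int.units_eq_one_or (φ g)).resolve_left hg
    | zero => exact ⟨0, zero_mem _, 0, zero_mem _, add_zero _⟩
    | add x y hxs hys ihx ihy =>
      obtain ⟨a, ha, b, hb, hab⟩ := ihx (R.span_range_ρ_eq_algAs.le hxs)
      obtain ⟨c, hc, d, hd, hcd⟩ := ihy (R.span_range_ρ_eq_algAs.le hys)
      refine ⟨a + c, add_mem ha hc, b + d, add_mem hb hd, ?_⟩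
      rw [add_add_add_comm, hab, hcd]
      rfl
    | smul r x hxs ihx =>
      obtain ⟨a, ha, b, hb, hab⟩ := ihx (R.span_range_ρ_eq_algAs.le hxs)
      refine ⟨r • a, Submodule.smul_mem _ _ ha, r • b, Submodule.smul_mem _ _ hb, ?_⟩
      rw [← smul_add, hab]
      rfl
  refine ⟨Subalgebra.inclusion R.algA_le_algAs, ⟨σ, h.mem_algAs⟩,
    Subalgebra.inclusion_injective _, fun x => R.mem_gradingAs_zero.trans ?_,
    fun x => (h.mem_gradingAs_one hT).trans ?_, fun x => ?_, Subtype.ext h.mul_self, ?_, ?_⟩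
  · exact ⟨fun hx => ⟨⟨x, hx⟩, rfl⟩, by rintro ⟨k, rfl⟩; exact k.2⟩
  · exact ⟨fun ⟨a, ha, hax⟩ => ⟨⟨a, ha⟩, Subtype.ext hax⟩,
      fun ⟨k, hk⟩ => ⟨k, k.2, congrArg Subtype.val hk⟩⟩
  · obtain ⟨y, hy, z, hz, rfl⟩ := hdecomp x
    obtain ⟨a, ha, haz⟩ := (h.mem_gradingAs_one hT).1 hz
    have h1 : Commute σ y.1 := (h.commute _ (R.mem_gradingAs_zero.1 hy)).symm
    have h2 : Commute σ z.1 := haz ▸ (h.commute a ha).symm.mul_right (Commute.refl σ)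
    exact Subtype.ext (h1.add_right h2).eq
  · -- even operators commute with `I` while odd ones anticommute
    rw [Submodule.disjoint_def]
    intro x h0 h1
    obtain ⟨a, ha, hax⟩ := (h.mem_gradingAs_one hT).1 h1
    have e0 := (R.commute_I (R.mem_gradingAs_zero.1 h0)).eq
    have e1 : x.1 * R.I = -(R.I * x.1) := by
      rw [← hax, mul_assoc, h.mul_I hT, mul_neg, ← mul_assoc, (R.commute_I ha).eq, mul_assoc]
    have e2 : (2 : ℝ) • (R.I * x.1) = 0 := by
      rw [two_smul]; nth_rewrite 1 [← e0]; rw [e1, neg_add_cancel]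
    have e3 : R.I * x.1 = 0 := (smul_eq_zero.1 e2).resolve_left two_ne_zero
    have e4 : R.I * (R.I * x.1) = -x.1 := by rw [← mul_assoc, R.I_mul_I, neg_one_mul]
    rw [e3, mul_zero] at e4
    exact Subtype.ext (neg_eq_zero.1 e4.symm)
  · rw [codisjoint_iff, eq_top_iff]
    exact fun x _ => Submodule.mem_sup.2 (hdecomp x)

/-! ### Normalizing the time reversal -/

/-- A scalar by which a group element acts on a nonzero vector has absolute value at most one, as
the orbit of the vector under the compact group is bounded. -/
theorem abs_le_one_of_ρ_apply_eq_smul [CompactSpace G] {g : G} {v : V} (hv : v ≠ 0) {c : ℝ}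
    (h : R.ρ g v = c • v) : |c| ≤ 1 := by
  by_contra! hc
  obtain ⟨C, hC⟩ := (isCompact_range (R.continuous_ρ v)).isBounded.exists_norm_le
  obtain ⟨k, hk⟩ := pow_unbounded_of_one_lt (C / ‖v‖) hc
  have hpow : ∀ k : ℕ, R.ρ (g ^ k) v = c ^ k • v := by
    intro k
    induction k with
    | zero => simp
    | succ k ih =>
      rw [pow_succ, map_mul, Module.End.mul_apply, h, map_smul, ih, smul_smul, pow_succ, mul_comm]
  have h1 := hC _ ⟨g ^ k, rfl⟩
  simp only [hpow, norm_smul, norm_pow, Real.norm_eq_abs] at h1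
  rw [div_lt_iff₀ (norm_pos_iff.2 hv)] at hk
  linarith

/-- If `𝒜` is central over `ℝ`, then `ρ(T) ^ 2` is a real scalar, equal to `±1` by compactness. -/
theorem isNormalizedTimeReversal_of_isCentral [CompactSpace G] [Nontrivial V]
    (hT : IsTimeReversal φ T) [Algebra.IsCentral ℝ R.algA] :
    R.IsNormalizedTimeReversal T (R.ρ T) 1 ∨ R.IsNormalizedTimeReversal T (R.ρ T) (-1) := by
  have hmem := R.ρ_mul_self_mem_algA hT
  have hcen : (⟨_, hmem⟩ : R.algA) ∈ Subalgebra.center ℝ R.algA :=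
    Subalgebra.mem_center_iff.2 fun b => Subtype.ext
      ((R.commute_ρ hT b.2).mul_right (R.commute_ρ hT b.2)).eq
  obtain ⟨c, hc⟩ := Algebra.mem_bot.1 (Algebra.IsCentral.out hcen)
  have hc' : R.ρ T * R.ρ T = algebraMap ℝ _ c := (congrArg Subtype.val hc).symm
  obtain ⟨v, hv⟩ := exists_ne (0 : V)
  have h1 : R.ρ (T * T) v = c • v := by rw [map_mul, hc']; rfl
  have hinv : R.ρ (T * T)⁻¹ (R.ρ (T * T) v) = v := by
    rw [← Module.End.mul_apply, ← map_mul, inv_mul_cancel, map_one, Module.End.one_apply]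
  have hc0 : c ≠ 0 := by
    rintro rfl
    rw [h1, zero_smul, map_zero] at hinv
    exact hv hinv.symm
  have h2 : R.ρ (T * T)⁻¹ v = c⁻¹ • v := by
    rw [h1, map_smul] at hinv
    rw [← hinv, smul_smul, inv_mul_cancel₀ hc0, one_smul, hinv]
  -- the bound holds for `T ^ 2` and for its inverse
  have hle := R.abs_le_one_of_ρ_apply_eq_smul hv h1
  have hge := R.abs_le_one_of_ρ_apply_eq_smul hv h2
  rw [abs_inv, inv_le_one₀ (abs_pos.2 hc0)] at hge
  have key : ∀ ε : ℝ, ε ≠ 0 → c = ε → R.IsNormalizedTimeReversal T (R.ρ T) ε := fun ε hε hcε =>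
    ⟨fun a ha => R.commute_ρ hT ha, hcε ▸ hc', hε, ⟨1, one_mem _, (one_mul _).symm⟩,
      ⟨1, one_mem _, one_mul _⟩⟩
  exact ((abs_eq zero_le_one).1 (le_antisymm hle hge)).imp (key 1 one_ne_zero)
    (key (-1) (by norm_num))

/-- If `𝒜` is a complex matrix algebra, then `ρ(T) ^ 2` is a complex scalar in `𝒜`, and dividing
`ρ T` by a square root of it gives a normalized time reversal of square one. -/
theorem exists_isNormalizedTimeReversal_of_complex (hT : IsTimeReversal φ T) [Nontrivial V] {n : ℕ}
    (e : R.algA ≃ₐ[ℝ] Mat ℂ n) : ∃ σ, R.IsNormalizedTimeReversal T σ 1 := by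
  have hmem := R.ρ_mul_self_mem_algA hT
  set z : R.algA := ⟨_, hmem⟩ with hz
  have hcen : e z ∈ Subalgebra.center ℂ (Mat ℂ n) := by
    refine Subalgebra.mem_center_iff.2 fun b => ?_
    obtain ⟨b, rfl⟩ := e.surjective b
    rw [← map_mul, ← map_mul]
    exact congrArg e (Subtype.ext
      ((R.commute_ρ hT b.2).mul_right (R.commute_ρ hT b.2)).eq)
  obtain ⟨ζ, hζ⟩ := Algebra.mem_bot.1 (Algebra.IsCentral.out hcen)
  obtain ⟨w, hw⟩ := IsAlgClosed.exists_pow_nat_eq ζ (n := 2) two_pos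
  let s : ℂ → R.algA := fun c => e.symm (algebraMap ℂ (Mat ℂ n) c)
  have smul : ∀ a b, s a * s b = s (a * b) := fun a b => by simp [s]
  have hzs : z = s (w ^ 2) := by rw [hw]; simp [s, hζ]
  have hs1 : s 1 = 1 := by simp [s]
  have hw0 : w ≠ 0 := by
    rintro rfl
    have hz0 : z = 0 := by rw [hzs]; simp [s]
    have h0 : R.ρ T * R.ρ T = 0 := congrArg Subtype.val hz0
    have h1 : R.ρ T⁻¹ * (R.ρ T * R.ρ T) * R.ρ T⁻¹ = 1 := by
      rw [← map_mul, ← map_mul, ← map_mul, inv_mul_cancel_left, mul_inv_cancel, map_one]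
    rw [h0, mul_zero, zero_mul] at h1
    exact zero_ne_one h1
  have hsc : ∀ c, ∀ a ∈ R.algA, Commute a (s c).1 := fun c a ha => by
    have : Commute (⟨a, ha⟩ : R.algA) (s c) := by
      apply e.injective
      simp [s, Algebra.commutes]
    exact congrArg Subtype.val this.eq
  refine ⟨(s w⁻¹).1 * R.ρ T, fun a ha => (hsc _ a ha).mul_right (R.commute_ρ hT ha), ?_,
    one_ne_zero, ⟨_, (s w⁻¹).2, rfl⟩, ⟨_, (s w).2, ?_⟩⟩
  · have h1 : (s w⁻¹).1 * R.ρ T * ((s w⁻¹).1 * R.ρ T) = (s w⁻¹ * s w⁻¹ * z).1 := by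
      change _ = (s w⁻¹).1 * (s w⁻¹).1 * (R.ρ T * R.ρ T)
      rw [mul_assoc, ← mul_assoc (R.ρ T), ← (R.commute_ρ hT (s w⁻¹).2).eq]
      simp only [mul_assoc]
    rw [h1, hzs, smul, smul, show w⁻¹ * w⁻¹ * w ^ 2 = 1 by field_simp, hs1, map_one]
    rfl
  · have h2 : s w * s w⁻¹ = 1 := by rw [smul, mul_inv_cancel₀ hw0, hs1]
    rw [← mul_assoc, show (s w).1 * (s w⁻¹).1 = 1 from congrArg Subtype.val h2, one_mul]

end PhiRep

/-! ### Dyson types -/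

/-- Tensoring `K(n)` with `Q` when `Q ⊗ K ≅ L(m)`. -/
theorem nonempty_tensor_algEquiv_of_matrix {A Q K L : Type*} [Ring A] [Algebra ℝ A] [Ring Q]
    [Algebra ℝ Q] [Ring K] [Algebra ℝ K] [Ring L] [Algebra ℝ L] {m n : ℕ}
    (e : A ≃ₐ[ℝ] Matrix (Fin n) (Fin n) K)
    (h : Nonempty (Q ⊗[ℝ] K ≃ₐ[ℝ] Matrix (Fin m) (Fin m) L)) :
    Nonempty (Q ⊗[ℝ] A ≃ₐ[ℝ] Matrix (Fin (m * n)) (Fin (m * n)) L) := by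
  obtain ⟨f⟩ := h
  obtain ⟨g⟩ := nonempty_tensor_matrix_algEquiv Q K n
  obtain ⟨k⟩ := nonempty_matrix_matrix_algEquiv L m n
  exact ⟨(((Algebra.TensorProduct.congr AlgEquiv.refl e).trans g).trans f.mapMatrix).trans k⟩

theorem nonempty_tensor_algEquiv_of_algEquiv {A Q K L : Type*} [Ring A] [Algebra ℝ A] [Ring Q]
    [Algebra ℝ Q] [Ring K] [Algebra ℝ K] [Ring L] [Algebra ℝ L] {n : ℕ}
    (e : A ≃ₐ[ℝ] Matrix (Fin n) (Fin n) K) (f : Q ⊗[ℝ] K ≃ₐ[ℝ] L) :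
    Nonempty (Q ⊗[ℝ] A ≃ₐ[ℝ] Matrix (Fin n) (Fin n) L) := by
  obtain ⟨g⟩ := nonempty_tensor_matrix_algEquiv Q K n
  exact ⟨((Algebra.TensorProduct.congr AlgEquiv.refl e).trans g).trans f.mapMatrix⟩

theorem nonempty_splitQuaternion_tensor_algEquiv (K : Type*) [Ring K] [Algebra ℝ K] :
    Nonempty (ℍ[ℝ,-1,0,1] ⊗[ℝ] K ≃ₐ[ℝ] Matrix (Fin 2) (Fin 2) K) := by
  obtain ⟨e⟩ := nonempty_splitQuaternion_algEquiv
  exact ⟨((Algebra.TensorProduct.congr e AlgEquiv.refl).trans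
    (Algebra.TensorProduct.comm ℝ _ _)).trans (matrixEquivTensor (Fin 2) ℝ K).symm⟩

theorem nonempty_complex_tensor_matrix_complex_algEquiv {A : Type*} [Ring A] [Algebra ℝ A] {n : ℕ}
    (e : A ≃ₐ[ℝ] Mat ℂ n) : Nonempty (ℂ ⊗[ℝ] A ≃ₐ[ℝ] Mat ℂ n × Mat ℂ n) := by
  obtain ⟨f⟩ := nonempty_complex_tensor_complex_algEquiv
  obtain ⟨g⟩ := nonempty_tensor_algEquiv_of_algEquiv e f
  let F : Mat (ℂ × ℂ) n →ₐ[ℝ] Mat ℂ n × Mat ℂ n :=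
    (AlgHom.fst ℝ ℂ ℂ).mapMatrix.prod (AlgHom.snd ℝ ℂ ℂ).mapMatrix
  refine ⟨g.trans (AlgEquiv.ofBijective F ⟨fun M N h => ?_, fun ⟨M, N⟩ => ?_⟩)⟩
  · obtain ⟨h1, h2⟩ := Prod.ext_iff.1 h
    exact Matrix.ext fun a b => Prod.ext (congrFun (congrFun h1 a) b) (congrFun (congrFun h2 a) b)
  · exact ⟨Matrix.of fun a b => (M a b, N a b), rfl⟩

section Uniqueness

variable {X : Type*} [Ring X] [Algebra ℝ X] {m n : ℕ}

theorem isCentral_of_algEquiv {Y : Type*} [Ring Y] [Algebra ℝ Y] [Algebra.IsCentral ℝ Y]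
    (e : X ≃ₐ[ℝ] Y) : Algebra.IsCentral ℝ X where
  out x hx := by
    have hex : e x ∈ Subalgebra.center ℝ Y := Subalgebra.mem_center_iff.2 fun y => by
      obtain ⟨z, rfl⟩ := e.surjective y
      rw [← map_mul, ← map_mul, Subalgebra.mem_center_iff.1 hx z]
    obtain ⟨c, hc⟩ := Algebra.mem_bot.1 (Algebra.IsCentral.out hex)
    exact Algebra.mem_bot.2 ⟨c, e.injective (by rw [AlgEquiv.commutes, ← hc])⟩

theorem isCentral_of_algEquiv_matrix_real (e : X ≃ₐ[ℝ] Mat ℝ n) : Algebra.IsCentral ℝ X :=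
  isCentral_of_algEquiv e

theorem isCentral_of_algEquiv_matrix_quaternion (e : X ≃ₐ[ℝ] Mat ℍ[ℝ] n) :
    Algebra.IsCentral ℝ X :=
  isCentral_of_algEquiv e

theorem false_of_isCentral_of_complex [Algebra.IsCentral ℝ X] (hn : 0 < n)
    (h : Nonempty (X ≃ₐ[ℝ] Mat ℂ n)) : False :=
  not_isCentral_matrix_complex hn (h.elim fun e => isCentral_of_algEquiv e.symm)

theorem false_of_real_of_complex (h : Nonempty (X ≃ₐ[ℝ] Mat ℝ m)) (hn : 0 < n)
    (h' : Nonempty (X ≃ₐ[ℝ] Mat ℂ n)) : False :=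
  h.elim fun e => have := isCentral_of_algEquiv_matrix_real e; false_of_isCentral_of_complex hn h'

theorem false_of_quaternion_of_complex (h : Nonempty (X ≃ₐ[ℝ] Mat ℍ[ℝ] m)) (hn : 0 < n)
    (h' : Nonempty (X ≃ₐ[ℝ] Mat ℂ n)) : False :=
  h.elim fun e =>
    have := isCentral_of_algEquiv_matrix_quaternion e; false_of_isCentral_of_complex hn h'

theorem false_of_real_of_quaternion (h : Nonempty (X ≃ₐ[ℝ] Mat ℝ m)) (hn : 0 < n)
    (h' : Nonempty (X ≃ₐ[ℝ] Mat ℍ[ℝ] n)) : False :=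
  h.elim fun e => h'.elim fun e' => not_nonempty_algEquiv_real_quaternion hn ⟨e.symm.trans e'⟩

theorem false_of_isSimpleRing_of_prod {K : Type} [Ring K] [Algebra ℝ K] [Nontrivial K]
    [IsSimpleRing X] (hn : 0 < n) (h : Nonempty (X ≃ₐ[ℝ] Mat K n × Mat K n)) : False :=
  have : Nonempty (Fin n) := ⟨⟨0, hn⟩⟩
  not_nonempty_algEquiv_prod h

end Uniqueness

/-- When `𝒜` is simple, the types of `𝒜` and of `𝒟` as matrix algebras over `ℝ`, `ℂ` or `ℍ`
determine the Dyson type. -/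
theorem PhiRep.HasDysonType.eq {G : Type*} [Group G] [TopologicalSpace G] {φ : G →* ℤˣ}
    {V : Type*} [NormedAddCommGroup V] [NormedSpace ℝ V] {R : PhiRep φ V} [IsSimpleRing R.algA]
    {t t' : DysonType} (ht : R.HasDysonType t) (ht' : R.HasDysonType t') : t = t' := by
  obtain ⟨m, hm, h⟩ := ht
  obtain ⟨n, hn, h'⟩ := ht'
  have hm2 : 0 < 2 * m := by omega
  have hn2 : 0 < 2 * n := by omega
  cases t
  case CR => exact (false_of_isSimpleRing_of_prod hm h.2.2).elim
  case CC1 => exact (false_of_isSimpleRing_of_prod hm h.2.2).elim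
  case CH => exact (false_of_isSimpleRing_of_prod hm h.2.2).elim
  all_goals
    cases t'
    case CR => exact (false_of_isSimpleRing_of_prod hn h'.2.2).elim
    case CC1 => exact (false_of_isSimpleRing_of_prod hn h'.2.2).elim
    case CH => exact (false_of_isSimpleRing_of_prod hn h'.2.2).elim
    all_goals
      first
      | rfl
      | exact (false_of_real_of_complex h.2.2 hn h'.2.2).elim
      | exact (false_of_real_of_complex h'.2.2 hm h.2.2).elim
      | exact (false_of_quaternion_of_complex h.2.2 hn h'.2.2).elim
      | exact (false_of_quaternion_of_complex h'.2.2 hm h.2.2).elim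
      | exact (false_of_real_of_quaternion h.2.2 hn h'.2.2).elim
      | exact (false_of_real_of_quaternion h'.2.2 hm h.2.2).elim
      | exact (false_of_real_of_complex h.1 hn2 h'.1).elim
      | exact (false_of_real_of_complex h'.1 hm2 h.1).elim
      | exact (false_of_quaternion_of_complex h.1 hn2 h'.1).elim
      | exact (false_of_quaternion_of_complex h'.1 hm2 h.1).elim
      | exact (false_of_real_of_quaternion h.1 hn h'.1).elim
      | exact (false_of_real_of_quaternion h'.1 hm h.1).elim
      | exact (false_of_real_of_quaternion h.1 hn2 h'.1).elim
      | exact (false_of_real_of_quaternion h'.1 hm2 h.1).elim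

namespace PhiRep

variable {G : Type*} [Group G] [TopologicalSpace G] {φ : G →* ℤˣ}
  {V : Type*} [NormedAddCommGroup V] [NormedSpace ℝ V] {R : PhiRep φ V} {T : G}

namespace IsNormalizedTimeReversal

variable {σ : Module.End ℝ V} {n : ℕ}

theorem hasDysonType_RR (h : R.IsNormalizedTimeReversal T σ 1) (hT : IsTimeReversal φ T)
    (hn : 0 < n) (e : R.algA ≃ₐ[ℝ] Mat ℝ n) : R.HasDysonType .RR := by
  obtain ⟨f⟩ := h.nonempty_algD_algEquiv hT
  obtain ⟨g⟩ := h.nonempty_algB_algEquiv hT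
  obtain ⟨f'⟩ := nonempty_tensor_algEquiv_of_matrix e (nonempty_splitQuaternion_tensor_algEquiv ℝ)
  obtain ⟨g'⟩ := nonempty_tensor_algEquiv_of_algEquiv e (Algebra.TensorProduct.rid ℝ ℝ ℂ)
  exact ⟨n, hn, ⟨f.trans f'⟩, ⟨g.trans g'⟩, ⟨e⟩⟩

theorem hasDysonType_HR (h : R.IsNormalizedTimeReversal T σ (-1)) (hT : IsTimeReversal φ T)
    (hn : 0 < n) (e : R.algA ≃ₐ[ℝ] Mat ℝ n) : R.HasDysonType .HR := by
  obtain ⟨f⟩ := h.nonempty_algD_algEquiv hT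
  obtain ⟨g⟩ := h.nonempty_algB_algEquiv hT
  obtain ⟨f'⟩ := nonempty_tensor_algEquiv_of_algEquiv e (Algebra.TensorProduct.rid ℝ ℝ ℍ[ℝ])
  obtain ⟨g'⟩ := nonempty_tensor_algEquiv_of_algEquiv e (Algebra.TensorProduct.rid ℝ ℝ ℂ)
  exact ⟨n, hn, ⟨f.trans f'⟩, ⟨g.trans g'⟩, ⟨e⟩⟩

theorem hasDysonType_CC2 (h : R.IsNormalizedTimeReversal T σ 1) (hT : IsTimeReversal φ T)
    (hn : 0 < n) (e : R.algA ≃ₐ[ℝ] Mat ℂ n) : R.HasDysonType .CC2 := by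
  obtain ⟨f⟩ := h.nonempty_algD_algEquiv hT
  obtain ⟨g⟩ := h.nonempty_algB_algEquiv hT
  obtain ⟨f'⟩ := nonempty_tensor_algEquiv_of_matrix e (nonempty_splitQuaternion_tensor_algEquiv ℂ)
  obtain ⟨g'⟩ := nonempty_complex_tensor_matrix_complex_algEquiv e
  exact ⟨n, hn, ⟨f.trans f'⟩, ⟨g.trans g'⟩, ⟨e⟩⟩

theorem hasDysonType_HH (h : R.IsNormalizedTimeReversal T σ 1) (hT : IsTimeReversal φ T)
    (hn : 0 < n) (e : R.algA ≃ₐ[ℝ] Mat ℍ[ℝ] n) : R.HasDysonType .HH := by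
  obtain ⟨f⟩ := h.nonempty_algD_algEquiv hT
  obtain ⟨g⟩ := h.nonempty_algB_algEquiv hT
  obtain ⟨f'⟩ := nonempty_tensor_algEquiv_of_matrix e
    (nonempty_splitQuaternion_tensor_algEquiv ℍ[ℝ])
  obtain ⟨g'⟩ := nonempty_tensor_algEquiv_of_matrix e nonempty_complex_tensor_quaternion_algEquiv
  exact ⟨n, hn, ⟨f.trans f'⟩, ⟨g.trans g'⟩, ⟨e⟩⟩

theorem hasDysonType_RH (h : R.IsNormalizedTimeReversal T σ (-1)) (hT : IsTimeReversal φ T)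
    (hn : 0 < n) (e : R.algA ≃ₐ[ℝ] Mat ℍ[ℝ] n) : R.HasDysonType .RH := by
  obtain ⟨f⟩ := h.nonempty_algD_algEquiv hT
  obtain ⟨g⟩ := h.nonempty_algB_algEquiv hT
  obtain ⟨f'⟩ := nonempty_tensor_algEquiv_of_matrix e
    nonempty_quaternion_tensor_quaternion_algEquiv
  obtain ⟨g'⟩ := nonempty_tensor_algEquiv_of_matrix e nonempty_complex_tensor_quaternion_algEquiv
  exact ⟨n, hn, ⟨f.trans f'⟩, ⟨g.trans g'⟩, ⟨e⟩⟩

theorem superSimilar {ε : ℝ} (h : R.IsNormalizedTimeReversal T σ ε) (hT : IsTimeReversal φ T)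
    (hn : 0 < n) {K : Type} [DivisionRing K] [Algebra ℝ K] (e : R.algA ≃ₐ[ℝ] Mat K n)
    {C : Type} [Ring C] [Algebra ℝ C] {𝒞 : ZMod 2 → Submodule ℝ C} [GradedAlgebra 𝒞]
    (hC : IsOddExtension K ε 𝒞) : SuperSimilar R.gradingAs 𝒞 :=
  ((h.isOddExtension hT).congr e.symm).superSimilar h.ne_zero hn hC

end IsNormalizedTimeReversal

/-- Every `φ`-irrep of a compact group with a time reversal `T` falls into one of five classes. -/
theorem IsIrreducible.classification [CompactSpace G] [FiniteDimensional ℝ V]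
    (hT : IsTimeReversal φ T) (hR : R.IsIrreducible) :
    (R.HasDysonType .RR ∧ SuperSimilar R.gradingAs (realCl 1 0) ∧ R.ρ T * R.ρ T = 1) ∨
    (R.HasDysonType .RH ∧ SuperSimilar R.gradingAs (realCl 3 0) ∧ R.ρ T * R.ρ T = -1) ∨
    (R.HasDysonType .CC2 ∧ SuperSimilar R.gradingAs (complexCl 1)) ∨
    (R.HasDysonType .HR ∧ SuperSimilar R.gradingAs (realCl 0 1) ∧ R.ρ T * R.ρ T = -1) ∨
    (R.HasDysonType .HH ∧ SuperSimilar R.gradingAs (realCl 0 3) ∧ R.ρ T * R.ρ T = 1) := by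
  have := hR.1
  have := R.isSimpleRing_algA hT hR
  obtain ⟨n, hn, ⟨⟨e⟩⟩ | ⟨⟨e⟩⟩ | ⟨⟨e⟩⟩⟩ := exists_algEquiv_matrix_of_isSimpleRing R.algA
  · have := isCentral_of_algEquiv_matrix_real e
    rcases R.isNormalizedTimeReversal_of_isCentral hT with h | h
    · exact .inl ⟨h.hasDysonType_RR hT hn e, h.superSimilar hT hn e isOddExtension_realCl_one_zero,
        by simpa using h.mul_self⟩
    · exact .inr (.inr (.inr (.inl ⟨h.hasDysonType_HR hT hn e,
        h.superSimilar hT hn e isOddExtension_realCl_zero_one, by simpa using h.mul_self⟩)))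
  · obtain ⟨σ, h⟩ := R.exists_isNormalizedTimeReversal_of_complex hT e
    exact .inr (.inr (.inl ⟨h.hasDysonType_CC2 hT hn e,
      h.superSimilar hT hn e isOddExtension_complexCl_one⟩))
  · have := isCentral_of_algEquiv_matrix_quaternion e
    rcases R.isNormalizedTimeReversal_of_isCentral hT with h | h
    · exact .inr (.inr (.inr (.inr ⟨h.hasDysonType_HH hT hn e,
        h.superSimilar hT hn e isOddExtension_realCl_zero_three, by simpa using h.mul_self⟩)))
    · exact .inr (.inl ⟨h.hasDysonType_RH hT hn e,
        h.superSimilar hT hn e isOddExtension_realCl_three_zero, by simpa using h.mul_self⟩)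

end PhiRep

/-! ### Factorizable groups -/

/-- If conjugation by the odd element `t = s (-1)` agrees on the even subgroup with conjugation by
`h⁻¹` for an even `h`, then `h t` is a time reversal; if `s` has normal image, then `t` itself
is. -/
theorem IsFactorizable.exists_isTimeReversal {G : Type*} [Group G] [TopologicalSpace G]
    [IsTopologicalGroup G] {φ : G →* ℤˣ} (h : IsFactorizable φ) : ∃ T, IsTimeReversal φ T := by
  obtain ⟨s, hs, h | h⟩ := h
  · have hmem : ∀ (u : G) (g : φ.ker), u * g * u⁻¹ ∈ φ.ker := fun u g =>
      (MonoidHom.normal_ker φ).conj_mem g g.2 u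
    let α : φ.ker ≃ₜ* φ.ker :=
      { toFun := fun g => ⟨s (-1) * g * (s (-1))⁻¹, hmem _ g⟩
        invFun := fun g => ⟨(s (-1))⁻¹ * g * s (-1), by simpa using hmem (s (-1))⁻¹ g⟩
        left_inv := fun g => Subtype.ext (by simp [mul_assoc])
        right_inv := fun g => Subtype.ext (by simp [mul_assoc])
        map_mul' := fun a b => Subtype.ext (by simp [mul_assoc])
        continuous_toFun := by fun_prop
        continuous_invFun := by fun_prop }
    obtain ⟨k, hk⟩ := h α
    refine ⟨k * s (-1), ?_, fun g hg => ?_⟩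
    · rw [map_mul, hs, MonoidHom.mem_ker.1 k.2, one_mul]
    · have h1 : s (-1) * g * (s (-1))⁻¹ = (k : G)⁻¹ * g * k := congrArg Subtype.val (hk ⟨g, hg⟩)
      rw [mul_inv_eq_iff_eq_mul] at h1
      rw [mul_assoc, h1]
      simp [mul_assoc]
  · refine ⟨s (-1), hs _, fun g _ => ?_⟩
    obtain ⟨ε, hε⟩ := h.conj_mem (s (-1)) ⟨-1, rfl⟩ g
    have h1 := congrArg φ hε
    rw [hs, map_mul, map_mul, hs, map_inv, mul_comm (φ g), mul_inv_cancel_right] at h1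
    rw [h1, eq_mul_inv_iff_mul_eq] at hε
    exact hε

theorem mainTheorem7 {G : Type*} [Group G] [TopologicalSpace G] [IsTopologicalGroup G]
    [CompactSpace G] (φ : G →* ℤˣ) (hφ : Function.Surjective φ)
    (V : Type*) [NormedAddCommGroup V] [NormedSpace ℝ V] [FiniteDimensional ℝ V] :
    (IsFactorizable φ → ∃ T : G, IsTimeReversal φ T) ∧
    ∀ T : G, IsTimeReversal φ T → ∀ R : PhiRep φ V, R.IsIrreducible →
      (∃ t, R.HasDysonType t) ∧
      (∀ t, R.HasDysonType t →
        t = .RR ∨ t = .RH ∨ t = .CC2 ∨ t = .HR ∨ t = .HH) ∧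
      (R.HasDysonType .RR → SuperSimilar R.gradingAs (realCl 1 0) ∧ R.ρ T * R.ρ T = 1) ∧
      (R.HasDysonType .RH → SuperSimilar R.gradingAs (realCl 3 0) ∧ R.ρ T * R.ρ T = -1) ∧
      (R.HasDysonType .CC2 → SuperSimilar R.gradingAs (complexCl 1)) ∧
      (R.HasDysonType .HR → SuperSimilar R.gradingAs (realCl 0 1) ∧ R.ρ T * R.ρ T = -1) ∧
      (R.HasDysonType .HH → SuperSimilar R.gradingAs (realCl 0 3) ∧ R.ρ T * R.ρ T = 1) := by
  refine ⟨fun h => h.exists_isTimeReversal, fun T hT R hR => ?_⟩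
  have := R.isSimpleRing_algA hT hR
  rcases hR.classification hT with ⟨h, h'⟩ | ⟨h, h'⟩ | ⟨h, h'⟩ | ⟨h, h'⟩ | ⟨h, h'⟩ <;>
    refine ⟨⟨_, h⟩, fun t ht => by simp [ht.eq h], fun ht => ?_, fun ht => ?_, fun ht => ?_,
      fun ht => ?_, fun ht => ?_⟩ <;>
    first
    | exact h'
    | exact DysonType.noConfusion (ht.eq h)
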